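/- Let $\varphi=\frac{1+\sqrt5}{2}$. The golden L is the translation surface obtained from the polygon with vertices $(0,0),(\varphi,0),(\varphi+1,0),(\varphi+1,\varphi),(\varphi,\varphi),(\varphi,\varphi+1),(0,\varphi+1),(0,\varphi)$ by identifying opposite parallel sides by translation. Its five marked points (Weierstrass points) are $1=(0,\varphi+\frac12)$, $2=(\frac\varphi2,\varphi+\frac12)$, $3=(\frac\varphi2,\frac\varphi2)$, $4=(\varphi+\frac12,\frac\varphi2)$, $5=(\varphi+\frac12,0)$, the midpoints of the sides of an inscribed pentagon. The double pentagon is the translation surface obtained from a regular pentagon of side length $1$ with horizontal bottom side and its image under $z\mapsto -z$ by gluing parallel sides by translation; its five side midpoints are labelled $5,4,2,1,3$ counterclockwise from the bottom side of the first pentagon. Put $P=\begin{pmatrix}1&\cos(\pi/5)\\0&\sin(\pi/5)\end{pmatrix}$ and $$\sigma_0=\begin{pmatrix}1&\varphi\\0&1\end{pmatrix},\quad \sigma_1=\begin{pmatrix}\varphi&\varphi\\1&\varphi\end{pmatrix},\quad \sigma_2=\begin{pmatrix}\varphi&1\\\varphi&\varphi\end{pmatrix},\quad \sigma_3=\begin{pmatrix}1&0\\\varphi&1\end{pmatrix}.$$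 A tree word is a finite (possibly empty) word $a=k_1k_2\cdots k_n$ with letters in $\{0,1,2,3\}$. It determines the direction $v_a=\sigma_{k_n}\cdots\sigma_{k_2}\sigma_{k_1}\begin{pmatrix}1\\0\end{pmatrix}$ on the golden L and the direction $Pv_a$ on the double pentagon, and the permutation $\tau_a=\tau_{k_1}\tau_{k_2}\cdots\tau_{k_n}$ of $\{1,\dots,5\}$ (rightmost factor first), where $\tau_0=(1\,2)(3\,4)$, $\tau_1=(1\,3)(2\,5)$, $\tau_2=(1\,4)(3\,5)$, $\tau_3=(2\,3)(4\,5)$. The derived word $a'$ is obtained from $a$ by removing, scanning from the left, disjoint pairs of adjacent equal letters, and the base word $\mu(a)$ is the word reached by deriving repeatedly until nothing changes. In a direction $v$ on one of these surfaces, a cylinder is a maximal connected family of periodic trajectories (closed geodesics in direction $v$ that avoid the cone points, i.e. the vertices). A point lies in the short (resp. long) cylinder if the surface has exactly two cylinders in direction $v$, their circumferences are different, and the point lies in the one with the smaller (resp. larger) circumference. It lies on a saddle connection if it lies on a straight segment in direction $v$ that joins two (possibly equal) cone points and has no cone point in its interior. **Corollary.** Each $\tau_k$ is an involution ($\tau_k^2=1$),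 and for every tree word $a$ one has $\tau_{\mu(a)}=\tau_a$. Moreover, for every tree word $a$ and every label $J\in\{1,\dots,5\}$: - on the golden L, the point $J$ lies in the long cylinder (resp. in the short cylinder, resp. on a saddle connection) in the direction $v_{\mu(a)}$ if and only if it does so in the direction $v_a$; - on the double pentagon, the side midpoint $J$ lies in the long cylinder (resp. in the short cylinder, resp. on a saddle connection) in the direction $Pv_{\mu(a)}$ if and only if it does so in the direction $Pv_a$. -/

import Mathlib

open scoped goldenRatio

/-! ## Translation surfaces glued from plane polygons -/

/-- The gluing data of a translation surface: a family of closed plane polygons `region i` with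
vertex sets `vertices i`, and a family of pairs of sides.  The pair `e` consists of the side
`segment ℝ (a e) (b e)` of the polygon `src e` and of the side of the polygon `tgt e` that
is its image under the translation by `shift e`. -/
structure PolygonGluing where
  ι : Type
  region : ι → Set ℂ
  vertices : ι → Set ℂ
  E : Type
  src : E → ι
  tgt : E → ι
  a : E → ℂ
  b : E → ℂ
  shift : E → ℂ

namespace PolygonGluing

variable (S : PolygonGluing)

/-- The disjoint union of the closed polygons. -/
abbrev Pre : Type := Σ i : S.ι, S.region i

/-- A point of a side is glued to its translate on the paired side. -/
def Glued (x y : S.Pre) : Prop :=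
  ∃ e : S.E, x.1 = S.src e ∧ y.1 = S.tgt e ∧ (x.2 : ℂ) ∈ segment ℝ (S.a e) (S.b e) ∧
    (y.2 : ℂ) = (x.2 : ℂ) + S.shift e

/-- The surface: the quotient space of the disjoint union by the side identifications. -/
def Surface : Type := Quot S.Glued

instance : TopologicalSpace S.Surface := inferInstanceAs (TopologicalSpace (Quot S.Glued))

/-- The point of the surface given by the point `z` of the polygon `i`. -/
def point (i : S.ι) (z : ℂ) (hz : z ∈ S.region i) : S.Surface := Quot.mk _ ⟨i, ⟨z, hz⟩⟩

/-- The cone points: the vertices of the polygons. -/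
def conePoints : Set S.Surface :=
  {p | ∃ (i : S.ι) (z : ℂ) (hz : z ∈ S.region i), z ∈ S.vertices i ∧ p = S.point i z hz}

/-- Just after time `t`, the path `γ` runs straight, with velocity `v`, inside one polygon. -/
def StraightAfter (γ : ℝ → S.Surface) (v : ℂ) (t : ℝ) : Prop :=
  ∃ (i : S.ι) (z : ℂ) (ε : ℝ), 0 < ε ∧ ∀ s ∈ Set.Icc 0 ε,
    ∃ h : z + (s : ℂ) * v ∈ S.region i, γ (t + s) = S.point i (z + (s : ℂ) * v) h

/-- Just before time `t`, the path `γ` runs straight, with velocity `v`, inside one polygon. -/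
def StraightBefore (γ : ℝ → S.Surface) (v : ℂ) (t : ℝ) : Prop :=
  ∃ (i : S.ι) (z : ℂ) (ε : ℝ), 0 < ε ∧ ∀ s ∈ Set.Icc 0 ε,
    ∃ h : z - (s : ℂ) * v ∈ S.region i, γ (t - s) = S.point i (z - (s : ℂ) * v) h

/-- `γ` is a periodic trajectory (closed geodesic) with velocity `v` and least period `T`; it
never meets a cone point.  Its length is `T * ‖v‖`. -/
def IsPeriodicTrajectory (v : ℂ) (T : ℝ) (γ : ℝ → S.Surface) : Prop :=
  0 < T ∧
  (∀ t, γ t ∉ S.conePoints ∧ S.StraightAfter γ v t ∧ S.StraightBefore γ v t) ∧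
  Function.Periodic γ T ∧ Set.InjOn γ (Set.Ico 0 T)

/-- The points that lie on a periodic trajectory in the direction `v`. -/
def periodicPart (v : ℂ) : Set S.Surface :=
  {p | ∃ (T : ℝ) (γ : ℝ → S.Surface), S.IsPeriodicTrajectory v T γ ∧ p ∈ Set.range γ}

/-- A cylinder in the direction `v`: a maximal (connected) family of periodic trajectories. -/
def IsCylinder (v : ℂ) (C : Set S.Surface) : Prop :=
  ∃ p ∈ S.periodicPart v, C = connectedComponentIn (S.periodicPart v) p

/-- `C` is filled by periodic trajectories in the direction `v` of length `ℓ`. -/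
def HasCircumference (v : ℂ) (C : Set S.Surface) (ℓ : ℝ) : Prop :=
  ∀ p ∈ C, ∃ (T : ℝ) (γ : ℝ → S.Surface),
    S.IsPeriodicTrajectory v T γ ∧ γ 0 = p ∧ Set.range γ ⊆ C ∧ T * ‖v‖ = ℓ

/-- In the direction `v` the surface decomposes into exactly two cylinders, the short one `C`
and the long one `D`. -/
def IsCylinderDecomposition (v : ℂ) (C D : Set S.Surface) : Prop :=
  {A | S.IsCylinder v A} = {C, D} ∧
  ∃ ℓ m : ℝ, S.HasCircumference v C ℓ ∧ S.HasCircumference v D m ∧ ℓ < m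

/-- `p` lies in the short cylinder in the direction `v`. -/
def InShortCylinder (v : ℂ) (p : S.Surface) : Prop :=
  ∃ C D, S.IsCylinderDecomposition v C D ∧ p ∈ C

/-- `p` lies in the long cylinder in the direction `v`. -/
def InLongCylinder (v : ℂ) (p : S.Surface) : Prop :=
  ∃ C D, S.IsCylinderDecomposition v C D ∧ p ∈ D

/-- `p` lies on a saddle connection in the direction `v`: a straight segment that joins two
cone points (possibly equal) and has no cone point in its interior. -/
def OnSaddleConnection (v : ℂ) (p : S.Surface) : Prop :=
  ∃ (T : ℝ) (γ : ℝ → S.Surface), 0 < T ∧ γ 0 ∈ S.conePoints ∧ γ T ∈ S.conePoints ∧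
    (∀ t ∈ Set.Ioo 0 T, γ t ∉ S.conePoints) ∧
    (∀ t ∈ Set.Ico 0 T, S.StraightAfter γ v t) ∧
    (∀ t ∈ Set.Ioc 0 T, S.StraightBefore γ v t) ∧ p ∈ γ '' Set.Icc 0 T

end PolygonGluing

/-! ## The golden L and the double pentagon -/

/-- The five labelled midpoints (Weierstrass points) `1, 2, 3, 4, 5`. -/
inductive Label
  | p1 | p2 | p3 | p4 | p5
  deriving DecidableEq

instance : Fintype Label where
  elems := {.p1, .p2, .p3, .p4, .p5}
  complete := by intro J; cases J <;> decide

/-- The golden L: the square `[0, φ]²` with a `1 × φ` rectangle on its right side and a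
`φ × 1` rectangle on its top side. -/
def goldenLRegion : Set ℂ :=
  {z | (0 ≤ z.re ∧ z.re ≤ φ + 1 ∧ 0 ≤ z.im ∧ z.im ≤ φ) ∨
    (0 ≤ z.re ∧ z.re ≤ φ ∧ 0 ≤ z.im ∧ z.im ≤ φ + 1)}

/-- The golden L surface.  The four pairs of opposite parallel sides are, in this order: the
left and right sides of the upper and of the lower part, and the bottom and top sides of
the left and of the right part. -/
noncomputable def goldenL : PolygonGluing where
  ι := Unit
  region := fun _ => goldenLRegion
  vertices := fun _ => {0, ⟨φ, 0⟩, ⟨φ + 1, 0⟩, ⟨φ + 1, φ⟩, ⟨φ, φ⟩, ⟨φ, φ + 1⟩, ⟨0, φ + 1⟩, ⟨0, φ⟩}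
  E := Fin 4
  src := fun _ => ()
  tgt := fun _ => ()
  a := ![⟨0, φ⟩, ⟨0, 0⟩, ⟨0, 0⟩, ⟨φ, 0⟩]
  b := ![⟨0, φ + 1⟩, ⟨0, φ⟩, ⟨φ, 0⟩, ⟨φ + 1, 0⟩]
  shift := ![⟨φ, 0⟩, ⟨φ + 1, 0⟩, ⟨0, φ + 1⟩, ⟨0, φ⟩]

/-- The midpoints of the sides of the pentagon with vertices
`(φ, 0), (φ + 1, 0), (φ, φ), (0, φ + 1), (0, φ)` inscribed in the golden L. -/
noncomputable def goldenLMidpointCoord : Label → ℂ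
  | .p1 => ⟨0, φ + 1 / 2⟩
  | .p2 => ⟨φ / 2, φ + 1 / 2⟩
  | .p3 => ⟨φ / 2, φ / 2⟩
  | .p4 => ⟨φ + 1 / 2, φ / 2⟩
  | .p5 => ⟨φ + 1 / 2, 0⟩

theorem goldenLMidpointCoord_mem (J : Label) : goldenLMidpointCoord J ∈ goldenLRegion := by
  have h := Real.one_lt_goldenRatio
  cases J <;> simp only [goldenLMidpointCoord, goldenLRegion, Set.mem_ofPred_eq]
  · right; refine ⟨?_, ?_, ?_, ?_⟩ <;> linarith
  · right; refine ⟨?_, ?_, ?_, ?_⟩ <;> linarith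
  · left; refine ⟨?_, ?_, ?_, ?_⟩ <;> linarith
  · left; refine ⟨?_, ?_, ?_, ?_⟩ <;> linarith
  · left; refine ⟨?_, ?_, ?_, ?_⟩ <;> linarith

/-- The midpoint with label `J` as a point of the golden L surface. -/
noncomputable def goldenLMidpoint (J : Label) : goldenL.Surface :=
  goldenL.point () (goldenLMidpointCoord J) (goldenLMidpointCoord_mem J)

/-- The vertices, in counterclockwise order, of the regular pentagon with side length `1` whose
bottom side runs from `0` to `1`: the side from `pentagonVertex j` to
`pentagonVertex (j + 1)` is the vector `exp (2πij/5)`.  (`pentagonVertex 5 = 0`.) -/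
noncomputable def pentagonVertex (j : ℕ) : ℂ :=
  ∑ m ∈ Finset.range j, Complex.exp (2 * Real.pi * Complex.I / 5) ^ m

/-- The closed regular pentagon. -/
noncomputable def pentagonRegion : Set ℂ :=
  convexHull ℝ (Set.range fun j : Fin 5 => pentagonVertex j)

/-- The double pentagon surface: the regular pentagon (`true`) and its image under `z ↦ -z`
(`false`), where each side of the first is glued by a translation to the parallel
side of the second. -/
noncomputable def doublePentagon : PolygonGluing where
  ι := Bool
  region := fun i => if i then pentagonRegion else {z | -z ∈ pentagonRegion}
  vertices := fun i => if i then Set.range fun j : Fin 5 => pentagonVertex j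
    else Set.range fun j : Fin 5 => -pentagonVertex j
  E := Fin 5
  src := fun _ => true
  tgt := fun _ => false
  a := fun j => pentagonVertex j
  b := fun j => pentagonVertex (j + 1)
  shift := fun j => -(pentagonVertex j + pentagonVertex (j + 1))

theorem pentagonVertex_five : pentagonVertex 5 = 0 := by
  have h : IsPrimitiveRoot (Complex.exp (2 * Real.pi * Complex.I / 5)) 5 := by
    have := Complex.isPrimitiveRoot_exp 5 (by norm_num)
    simpa using this
  exact h.geom_sum_eq_zero (by norm_num)

theorem pentagonVertex_mem (j : ℕ) (hj : j ≤ 5) : pentagonVertex j ∈ pentagonRegion := by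
  rcases Nat.lt_or_ge j 5 with h | h
  · exact subset_convexHull ℝ _ ⟨⟨j, h⟩, rfl⟩
  · obtain rfl : j = 5 := le_antisymm hj h
    have h0 : pentagonVertex 5 = pentagonVertex 0 := by
      rw [pentagonVertex_five]; simp [pentagonVertex]
    rw [h0]
    exact subset_convexHull ℝ _ ⟨0, rfl⟩

/-- The side of the pentagon that carries the label: counterclockwise from the bottom side, the
labels are `5, 4, 2, 1, 3`. -/
def sideOfLabel : Label → Fin 5
  | .p1 => 3
  | .p2 => 2
  | .p3 => 4
  | .p4 => 1
  | .p5 => 0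

/-- The midpoint of the side with label `J` of the regular pentagon. -/
noncomputable def pentagonMidpointCoord (J : Label) : ℂ :=
  midpoint ℝ (pentagonVertex (sideOfLabel J)) (pentagonVertex (sideOfLabel J + 1))

theorem pentagonMidpointCoord_mem (J : Label) : pentagonMidpointCoord J ∈ pentagonRegion :=
  (convex_convexHull ℝ _).midpoint_mem
    (pentagonVertex_mem _ (sideOfLabel J).isLt.le) (pentagonVertex_mem _ (sideOfLabel J).isLt)

/-- The side midpoint with label `J` as a point of the double pentagon surface. -/
noncomputable def doublePentagonMidpoint (J : Label) : doublePentagon.Surface :=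
  doublePentagon.point true (pentagonMidpointCoord J)
    (by simpa [doublePentagon] using pentagonMidpointCoord_mem J)

/-! ## Tree words -/

/-- A tree word: a finite sequence `k₁ k₂ … kₙ` of letters in `{0, 1, 2, 3}`. -/
abbrev TreeWord : Type := List (Fin 4)

/-- The generators `σ₀, σ₁, σ₂, σ₃` of the Veech group of the golden L. -/
noncomputable def veechGen : Fin 4 → Matrix (Fin 2) (Fin 2) ℝ :=
  ![!![1, φ; 0, 1], !![φ, φ; 1, φ], !![φ, 1; φ, φ], !![1, 0; φ, 1]]

/-- The matrix `P` that takes the golden L to the double pentagon. -/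
noncomputable def goldenToPentagon : Matrix (Fin 2) (Fin 2) ℝ :=
  !![1, Real.cos (Real.pi / 5); 0, Real.sin (Real.pi / 5)]

/-- The vector `σ_{kₙ} ⋯ σ_{k₂} σ_{k₁} (1, 0)` in the direction of the tree word `k₁ k₂ … kₙ`. -/
noncomputable def wordVector (a : TreeWord) : Fin 2 → ℝ :=
  a.foldl (fun v k => (veechGen k).mulVec v) ![1, 0]

/-- The direction of a tree word on the golden L, as a complex number. -/
noncomputable def goldenLDirection (a : TreeWord) : ℂ :=
  ⟨wordVector a 0, wordVector a 1⟩

/-- The direction of a tree word on the double pentagon (and on the regular pentagon). -/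
noncomputable def pentagonDirection (a : TreeWord) : ℂ :=
  ⟨goldenToPentagon.mulVec (wordVector a) 0, goldenToPentagon.mulVec (wordVector a) 1⟩

/-- The permutations `τ₀ = (1 2)(3 4)`, `τ₁ = (1 3)(2 5)`, `τ₂ = (1 4)(3 5)`, `τ₃ = (2 3)(4 5)`
of the labels. -/
def labelPerm : Fin 4 → Equiv.Perm Label :=
  ![Equiv.swap .p1 .p2 * Equiv.swap .p3 .p4, Equiv.swap .p1 .p3 * Equiv.swap .p2 .p5,
    Equiv.swap .p1 .p4 * Equiv.swap .p3 .p5, Equiv.swap .p2 .p3 * Equiv.swap .p4 .p5]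

/-- The product `τ_{k₁} τ_{k₂} ⋯ τ_{kₙ}` (the rightmost factor acts first). -/
def wordPerm (a : TreeWord) : Equiv.Perm Label := (a.map labelPerm).prod

/-- The derived word: scanning from the left, remove disjoint pairs of adjacent equal letters. -/
def derivedWord : TreeWord → TreeWord
  | [] => []
  | [k] => [k]
  | k :: l :: w => if k = l then derivedWord w else k :: derivedWord (l :: w)

/-- A base word is a word that equals its derived word. -/
def IsBaseWord (a : TreeWord) : Prop := derivedWord a = a

/-- The base word `μ(a)`: derive `a` until nothing changes any more; `a.length` steps suffice. -/
def baseWord (a : TreeWord) : TreeWord := derivedWord^[a.length] a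

theorem derivedWord_length (a : TreeWord) :
    derivedWord a = a ∨ (derivedWord a).length < a.length := by
  induction a using derivedWord.induct with
  | case1 => left; rfl
  | case2 k => left; rfl
  | case3 k w ih =>
    right
    rw [derivedWord, if_pos rfl]
    rcases ih with h | h
    · rw [h]; simp
    · simp; omega
  | case4 k l w hkl ih =>
    rw [derivedWord, if_neg hkl]
    rcases ih with h | h
    · left; rw [h]
    · right; simpa using h

theorem isBaseWord_baseWord (a : TreeWord) : IsBaseWord (baseWord a) := by
  have key : ∀ (n : ℕ) (b : TreeWord), b.length ≤ n → IsBaseWord (derivedWord^[n] b) := by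
    intro n
    induction n with
    | zero =>
      intro b hb
      obtain rfl : b = [] := List.length_eq_zero_iff.mp (Nat.le_zero.mp hb)
      rfl
    | succ n ih =>
      intro b hb
      rw [Function.iterate_succ_apply]
      rcases derivedWord_length b with h | h
      · rw [h, Function.iterate_fixed h]; exact h
      · exact ih _ (by omega)
  exact key _ a le_rfl

/-! The affine symmetries of the golden L carry the proof. An affine homeomorphism with derivative
`A` takes periodic trajectories, cylinders and saddle connections in direction `v` to those in
direction `A v`, and it multiplies all lengths in direction `v` by one common factor. So it
preserves the position (long cylinder, short cylinder, saddle connection) of a point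
(`AffineIso.samePosition`).

Each `σ_k` is the derivative of such a symmetry, acting on the Weierstrass points by `τ_k`. Hence
`J` in direction `σ_k v` has the same position as `τ_k J` in direction `v`
(`sameWeierstrass_veechGen`). By induction on the word, `J` in direction `v_a` has the position of
`τ_a J` in the horizontal direction (`samePosition_wordPerm`). Because `τ_k² = 1`, removing a pair
of adjacent equal letters does not change `τ_a`, so `τ_{μ(a)} = τ_a`. Both directions are thus
compared with the horizontal one at the same label.

The symmetries are generated by three orientation-reversing involutions: the diagonal reflection
`D`, the reflection `R` of both horizontal cylinders in their core curves, and a sheared reflection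
`T` with `T R = σ₀` on derivatives. The shear exists because both cylinders have the same modulus
`(φ + 1)/φ = φ/1 = φ`. On derivatives, `σ₁ = σ₀ D R σ₀`, `σ₂ = D σ₁ D` and `σ₃ = D σ₀ D`. An
involution serves as its own inverse, so one cut-and-paste map suffices for each.

The double pentagon reduces to the golden L: `P` is the derivative of an affine homeomorphism that
keeps the inscribed pentagon whole, reassembles the rest of the L into the second pentagon, and
matches the labels (`pentagonIso`, `pentagonIso_midpoint`). -/

namespace PolygonGluing

open Filter Topology

/-! ### Equality of points of the surface in coordinates -/

/-- The point `z` of the polygon `i` and the point `w` of the polygon `j` give the same point of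
the surface. -/
def Same (S : PolygonGluing) (i : S.ι) (z : ℂ) (j : S.ι) (w : ℂ) : Prop :=
  ∃ (hz : z ∈ S.region i) (hw : w ∈ S.region j), S.point i z hz = S.point j w hw

theorem Same.refl {S : PolygonGluing} {i : S.ι} {z : ℂ} (hz : z ∈ S.region i) : S.Same i z i z :=
  ⟨hz, hz, rfl⟩

theorem Same.of_eq {S : PolygonGluing} {i : S.ι} {z w : ℂ} (h : z = w) (hz : z ∈ S.region i) :
    S.Same i z i w := by
  subst h; exact .refl hz

theorem Same.symm {S : PolygonGluing} {i j : S.ι} {z w : ℂ} (h : S.Same i z j w) :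
    S.Same j w i z :=
  let ⟨hz, hw, e⟩ := h
  ⟨hw, hz, e.symm⟩

theorem Same.trans {S : PolygonGluing} {i j k : S.ι} {z w u : ℂ} (h : S.Same i z j w)
    (h' : S.Same j w k u) : S.Same i z k u :=
  let ⟨hz, _, e⟩ := h
  let ⟨_, hu, e'⟩ := h'
  ⟨hz, hu, e.trans e'⟩

theorem Same.glue {S : PolygonGluing} (e : S.E) {z : ℂ} (hs : z ∈ segment ℝ (S.a e) (S.b e))
    (hz : z ∈ S.region (S.src e)) (hw : z + S.shift e ∈ S.region (S.tgt e)) :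
    S.Same (S.src e) z (S.tgt e) (z + S.shift e) :=
  ⟨hz, hw, Quot.sound ⟨e, rfl, rfl, hs, rfl⟩⟩

/-! ### Affine maps between surfaces -/

/-- A continuous map between surfaces that respects cone points and maps straight paths with
velocity `v` to straight paths with velocity `A v`. -/
structure IsAffineMap {S S' : PolygonGluing} (A : ℂ →L[ℝ] ℂ) (f : S.Surface → S'.Surface) :
    Prop where
  continuous : Continuous f
  map_conePoints : ∀ p ∈ S.conePoints, f p ∈ S'.conePoints
  straight : ∀ (i : S.ι) (z v : ℂ) (ε : ℝ), 0 < ε →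
    (∀ s ∈ Set.Icc 0 ε, z + (s : ℂ) * v ∈ S.region i) →
    ∃ (i' : S'.ι) (z' : ℂ) (δ : ℝ), 0 < δ ∧ δ ≤ ε ∧ ∀ s ∈ Set.Icc 0 δ,
      ∀ h : z + (s : ℂ) * v ∈ S.region i, ∃ h' : z' + (s : ℂ) * A v ∈ S'.region i',
        f (S.point i (z + (s : ℂ) * v) h) = S'.point i' (z' + (s : ℂ) * A v) h'

section

variable {S S' : PolygonGluing} {A : ℂ →L[ℝ] ℂ} {f : S.Surface → S'.Surface}

theorem IsAffineMap.straightAfter (hf : IsAffineMap A f) {γ : ℝ → S.Surface} {v : ℂ} {t : ℝ}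
    (h : S.StraightAfter γ v t) : S'.StraightAfter (f ∘ γ) (A v) t := by
  obtain ⟨i, z, ε, hε, h⟩ := h
  obtain ⟨i', z', δ, hδ, hδε, h'⟩ := hf.straight i z v ε hε fun s hs => (h s hs).1
  refine ⟨i', z', δ, hδ, fun s hs => ?_⟩
  obtain ⟨h1, h2⟩ := h s ⟨hs.1, hs.2.trans hδε⟩
  obtain ⟨h3, h4⟩ := h' s hs h1
  exact ⟨h3, by rw [Function.comp, h2, h4]⟩

/-- Running backwards with velocity `v` is running forwards with velocity `-v`, so the forward
condition in `IsAffineMap` suffices. -/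
theorem IsAffineMap.straightBefore (hf : IsAffineMap A f) {γ : ℝ → S.Surface} {v : ℂ} {t : ℝ}
    (h : S.StraightBefore γ v t) : S'.StraightBefore (f ∘ γ) (A v) t := by
  obtain ⟨i, z, ε, hε, h⟩ := h
  simp only [sub_eq_add_neg z, ← mul_neg] at h
  obtain ⟨i', z', δ, hδ, hδε, h'⟩ := hf.straight i z (-v) ε hε fun s hs => (h s hs).1
  refine ⟨i', z', δ, hδ, fun s hs => ?_⟩
  obtain ⟨h1, h2⟩ := h s ⟨hs.1, hs.2.trans hδε⟩
  obtain ⟨h3, h4⟩ := h' s hs h1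
  simp only [sub_eq_add_neg z', ← mul_neg, ← map_neg]
  exact ⟨h3, by rw [Function.comp, h2, h4]⟩

end

/-- A homeomorphism between surfaces that is affine with derivative `A`, with affine inverse. -/
structure AffineIso (S S' : PolygonGluing) (A B : ℂ →L[ℝ] ℂ) where
  toHomeomorph : S.Surface ≃ₜ S'.Surface
  left_inv : ∀ v, B (A v) = v
  right_inv : ∀ v, A (B v) = v
  affine : IsAffineMap A toHomeomorph
  affine_symm : IsAffineMap B toHomeomorph.symm

namespace AffineIso

variable {S S' : PolygonGluing} {A B : ℂ →L[ℝ] ℂ} (F : AffineIso S S' A B)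

/-- The inverse of an affine homeomorphism. -/
def symm : AffineIso S' S B A where
  toHomeomorph := F.toHomeomorph.symm
  left_inv := F.right_inv
  right_inv := F.left_inv
  affine := F.affine_symm
  affine_symm := F.affine

theorem mem_conePoints_iff {p : S.Surface} :
    F.toHomeomorph p ∈ S'.conePoints ↔ p ∈ S.conePoints := by
  refine ⟨fun h => ?_, F.affine.map_conePoints p⟩
  simpa using F.affine_symm.map_conePoints _ h

theorem isPeriodicTrajectory {v : ℂ} {T : ℝ} {γ : ℝ → S.Surface}
    (h : S.IsPeriodicTrajectory v T γ) :
    S'.IsPeriodicTrajectory (A v) T (F.toHomeomorph ∘ γ) := by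
  obtain ⟨hT, hγ, hper, hinj⟩ := h
  refine ⟨hT, fun t => ⟨?_, F.affine.straightAfter (hγ t).2.1, F.affine.straightBefore (hγ t).2.2⟩,
    hper.comp _, F.toHomeomorph.injective.comp_injOn hinj⟩
  rw [Function.comp, F.mem_conePoints_iff]
  exact (hγ t).1

theorem map_mem_periodicPart {v : ℂ} {p : S.Surface} (h : p ∈ S.periodicPart v) :
    F.toHomeomorph p ∈ S'.periodicPart (A v) := by
  obtain ⟨T, γ, hγ, t, rfl⟩ := h
  exact ⟨T, _, F.isPeriodicTrajectory hγ, t, rfl⟩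

theorem image_periodicPart (v : ℂ) :
    F.toHomeomorph '' S.periodicPart v = S'.periodicPart (A v) := by
  ext p
  constructor
  · rintro ⟨p, hp, rfl⟩
    exact F.map_mem_periodicPart hp
  · intro hp
    refine ⟨F.toHomeomorph.symm p, ?_, by simp⟩
    have := F.symm.map_mem_periodicPart hp
    rwa [F.left_inv] at this

theorem isCylinder {v : ℂ} {C : Set S.Surface} (h : S.IsCylinder v C) :
    S'.IsCylinder (A v) (F.toHomeomorph '' C) := by
  obtain ⟨p, hp, rfl⟩ := h
  refine ⟨_, F.map_mem_periodicPart hp, ?_⟩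
  rw [F.toHomeomorph.image_connectedComponentIn hp, F.image_periodicPart]

theorem setOf_isCylinder {v : ℂ} {C D : Set S.Surface} (h : {A | S.IsCylinder v A} = {C, D}) :
    {X | S'.IsCylinder (A v) X} = {F.toHomeomorph '' C, F.toHomeomorph '' D} := by
  rw [← Set.image_pair, ← h]
  ext X
  constructor
  · intro hX
    refine ⟨F.toHomeomorph.symm '' X, ?_, by simp [Set.image_image]⟩
    have := F.symm.isCylinder (v := A v) (C := X) hX
    rwa [F.left_inv] at this
  · rintro ⟨C, hC, rfl⟩
    exact F.isCylinder hC

/-- The factor depends on `v` but not on the trajectory: all circumferences in one direction scale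
alike, so the strict inequality between the short and the long one survives. -/
theorem exists_norm_eq (F : AffineIso S S' A B) (v : ℂ) : ∃ c : ℝ, 0 < c ∧ ‖A v‖ = c * ‖v‖ := by
  rcases eq_or_ne v 0 with rfl | hv
  · exact ⟨1, one_pos, by simp⟩
  · have hA : A v ≠ 0 := fun h => hv (by rw [← F.left_inv v, h, map_zero])
    exact ⟨‖A v‖ / ‖v‖, div_pos (norm_pos_iff.2 hA) (norm_pos_iff.2 hv),
      (div_mul_cancel₀ _ (norm_ne_zero_iff.2 hv)).symm⟩

theorem hasCircumference {v : ℂ} {C : Set S.Surface} {ℓ c : ℝ} (hc : ‖A v‖ = c * ‖v‖)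
    (h : S.HasCircumference v C ℓ) :
    S'.HasCircumference (A v) (F.toHomeomorph '' C) (c * ℓ) := by
  rintro _ ⟨p, hp, rfl⟩
  obtain ⟨T, γ, hγ, h0, hr, hT⟩ := h p hp
  refine ⟨T, _, F.isPeriodicTrajectory hγ, by simp [h0], ?_, ?_⟩
  · rw [Set.range_comp]
    exact Set.image_mono hr
  · rw [hc, ← hT]; ring

theorem isCylinderDecomposition {v : ℂ} {C D : Set S.Surface}
    (h : S.IsCylinderDecomposition v C D) :
    S'.IsCylinderDecomposition (A v) (F.toHomeomorph '' C) (F.toHomeomorph '' D) := by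
  obtain ⟨h1, ℓ, m, hℓ, hm, hlt⟩ := h
  obtain ⟨c, hc, hcv⟩ := F.exists_norm_eq v
  exact ⟨F.setOf_isCylinder h1, c * ℓ, c * m, F.hasCircumference hcv hℓ, F.hasCircumference hcv hm,
    mul_lt_mul_of_pos_left hlt hc⟩

theorem inShortCylinder {v : ℂ} {p : S.Surface} (h : S.InShortCylinder v p) :
    S'.InShortCylinder (A v) (F.toHomeomorph p) :=
  let ⟨_, _, h, hp⟩ := h
  ⟨_, _, F.isCylinderDecomposition h, Set.mem_image_of_mem _ hp⟩

theorem inLongCylinder {v : ℂ} {p : S.Surface} (h : S.InLongCylinder v p) :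
    S'.InLongCylinder (A v) (F.toHomeomorph p) :=
  let ⟨_, _, h, hp⟩ := h
  ⟨_, _, F.isCylinderDecomposition h, Set.mem_image_of_mem _ hp⟩

theorem onSaddleConnection {v : ℂ} {p : S.Surface} (h : S.OnSaddleConnection v p) :
    S'.OnSaddleConnection (A v) (F.toHomeomorph p) := by
  obtain ⟨T, γ, hT, h0, h1, h2, h3, h4, h5⟩ := h
  refine ⟨T, F.toHomeomorph ∘ γ, hT, F.mem_conePoints_iff.2 h0, F.mem_conePoints_iff.2 h1,
    fun t ht => mt F.mem_conePoints_iff.1 (h2 t ht), fun t ht => F.affine.straightAfter (h3 t ht),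
    fun t ht => F.affine.straightBefore (h4 t ht), ?_⟩
  rw [Set.image_comp]
  exact Set.mem_image_of_mem _ h5

end AffineIso

/-! ### The position of a point with respect to a direction -/

/-- The point `p` of `S` lies in the long cylinder, in the short cylinder or on a saddle connection
in the direction `v` if and only if the point `p'` of `S'` does so in the direction `v'`. -/
def SamePosition (S : PolygonGluing) (v : ℂ) (p : S.Surface) (S' : PolygonGluing) (v' : ℂ)
    (p' : S'.Surface) : Prop :=
  (S.InLongCylinder v p ↔ S'.InLongCylinder v' p') ∧
  (S.InShortCylinder v p ↔ S'.InShortCylinder v' p') ∧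
  (S.OnSaddleConnection v p ↔ S'.OnSaddleConnection v' p')

theorem SamePosition.symm {S S' : PolygonGluing} {v v' : ℂ} {p : S.Surface} {p' : S'.Surface}
    (h : SamePosition S v p S' v' p') : SamePosition S' v' p' S v p :=
  ⟨h.1.symm, h.2.1.symm, h.2.2.symm⟩

theorem SamePosition.trans {S S' S'' : PolygonGluing} {v v' v'' : ℂ} {p : S.Surface}
    {p' : S'.Surface} {p'' : S''.Surface} (h : SamePosition S v p S' v' p')
    (h' : SamePosition S' v' p' S'' v'' p'') : SamePosition S v p S'' v'' p'' :=
  ⟨h.1.trans h'.1, h.2.1.trans h'.2.1, h.2.2.trans h'.2.2⟩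

/-- All three positions are affine invariants; the converse implications come from applying the
forward ones to the inverse map. -/
theorem AffineIso.samePosition {S S' : PolygonGluing} {A B : ℂ →L[ℝ] ℂ} (F : AffineIso S S' A B)
    (v : ℂ) (p : S.Surface) : SamePosition S' (A v) (F.toHomeomorph p) S v p := by
  have hp : F.symm.toHomeomorph (F.toHomeomorph p) = p := F.toHomeomorph.symm_apply_apply p
  refine ⟨⟨fun h => ?_, F.inLongCylinder⟩, ⟨fun h => ?_, F.inShortCylinder⟩,
    ⟨fun h => ?_, F.onSaddleConnection⟩⟩
  · simpa only [hp, F.left_inv] using F.symm.inLongCylinder h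
  · simpa only [hp, F.left_inv] using F.symm.inShortCylinder h
  · simpa only [hp, F.left_inv] using F.symm.onSaddleConnection h

/-! ### Cutting and pasting -/

/-- A map between surfaces given by cutting the polygons of `S` into finitely many convex pieces
and moving each piece by an affine map with derivative `A` into a polygon of `S'`. -/
structure CutPaste (S S' : PolygonGluing) (A : ℂ →L[ℝ] ℂ) where
  κ : Type
  finite : Finite κ
  src : κ → S.ι
  tgt : κ → S'.ι
  piece : κ → Set ℂ
  trans : κ → ℂ
  isClosed_piece : ∀ k, IsClosed (piece k)
  convex_piece : ∀ k, Convex ℝ (piece k)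
  cover : ∀ i, ∀ z ∈ S.region i, ∃ k, src k = i ∧ z ∈ piece k
  compat : ∀ k l z, src k = src l → z ∈ S.region (src k) → z ∈ piece k → z ∈ piece l →
    S'.Same (tgt k) (A z + trans k) (tgt l) (A z + trans l)
  glue : ∀ e, ∀ z ∈ segment ℝ (S.a e) (S.b e), z ∈ S.region (S.src e) →
    z + S.shift e ∈ S.region (S.tgt e) → ∃ k l, src k = S.src e ∧ src l = S.tgt e ∧
      z ∈ piece k ∧ z + S.shift e ∈ piece l ∧
      S'.Same (tgt k) (A z + trans k) (tgt l) (A (z + S.shift e) + trans l)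
  vertex : ∀ i, ∀ z ∈ S.vertices i, z ∈ S.region i →
    ∃ k, src k = i ∧ z ∈ piece k ∧ A z + trans k ∈ S'.vertices (tgt k)

namespace CutPaste

variable {S S' : PolygonGluing} {A : ℂ →L[ℝ] ℂ} (F : CutPaste S S' A)

/-- `Same` includes membership in the polygons, so the case `k = l` of `compat` already says that a
piece lands inside its target polygon. -/
theorem mem_region {k : F.κ} {z : ℂ} (hz : z ∈ S.region (F.src k)) (h : z ∈ F.piece k) :
    A z + F.trans k ∈ S'.region (F.tgt k) :=
  (F.compat k k z rfl hz h h).1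

/-- The map on the disjoint union of the polygons. -/
noncomputable def preMap (x : S.Pre) : S'.Surface :=
  have h := F.cover x.1 x.2 x.2.2
  S'.point (F.tgt h.choose) (A x.2 + F.trans h.choose)
    (F.mem_region (by rw [h.choose_spec.1]; exact x.2.2) h.choose_spec.2)

/-- Independence of the chosen piece: on overlaps the pieces agree in the target surface by
`compat`. -/
theorem preMap_eq (x : S.Pre) (k : F.κ) (hk : F.src k = x.1) (hz : (x.2 : ℂ) ∈ F.piece k) :
    F.preMap x = S'.point (F.tgt k) (A x.2 + F.trans k)
      (F.mem_region (by rw [hk]; exact x.2.2) hz) := by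
  have h := F.cover x.1 x.2 x.2.2
  exact (F.compat h.choose k x.2 (h.choose_spec.1.trans hk.symm)
    (by rw [h.choose_spec.1]; exact x.2.2) h.choose_spec.2 hz).2.2

/-- The map of surfaces obtained by cutting and pasting. -/
noncomputable def toFun : S.Surface → S'.Surface :=
  Quot.lift F.preMap (by
    rintro ⟨i, z, hz⟩ ⟨j, w, hw⟩ ⟨e, hi, hj, hs, hzw⟩
    dsimp only at hi hj hs hzw
    subst hi hj hzw
    obtain ⟨k, l, hk, hl, hzk, hzl, _, _, h⟩ := F.glue e z hs hz hw
    rw [F.preMap_eq _ k hk hzk, F.preMap_eq _ l hl hzl]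
    exact h)

theorem toFun_point {i : S.ι} {z : ℂ} (hz : z ∈ S.region i) (k : F.κ) (hk : F.src k = i)
    (hzk : z ∈ F.piece k) :
    F.toFun (S.point i z hz) = S'.point (F.tgt k) (A z + F.trans k)
      (F.mem_region (by rw [hk]; exact hz) hzk) :=
  F.preMap_eq ⟨i, z, hz⟩ k hk hzk

theorem toFun_eq_of_same {i : S.ι} {z : ℂ} (hz : z ∈ S.region i) (k : F.κ) (hk : F.src k = i)
    (hzk : z ∈ F.piece k) {j : S'.ι} {w : ℂ} (hw : w ∈ S'.region j)
    (h : S'.Same (F.tgt k) (A z + F.trans k) j w) : F.toFun (S.point i z hz) = S'.point j w hw := by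
  rw [F.toFun_point hz k hk hzk]
  exact h.2.2

/-- Pasting lemma: the pieces form a finite closed cover of each polygon, and on each piece the map
is an affine map followed by the quotient map. -/
theorem continuous_toFun : Continuous F.toFun := by
  have := F.finite
  refine continuous_quot_lift _ (continuous_sigma fun i => ?_)
  refine (locallyFinite_of_finite
    fun k : {k // F.src k = i} => {z : S.region i | (z : ℂ) ∈ F.piece k}).continuous
    ?_ (fun k => (F.isClosed_piece k).preimage continuous_subtype_val) ?_
  · refine Set.eq_univ_of_forall fun z => ?_
    obtain ⟨k, hk, hz⟩ := F.cover i z z.2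
    exact Set.mem_iUnion.2 ⟨⟨k, hk⟩, hz⟩
  · rintro ⟨k, rfl⟩
    rw [continuousOn_iff_continuous_domRestrict]
    have hc : Continuous fun z : {z : S.region (F.src k) | (z : ℂ) ∈ F.piece k} =>
        (Quot.mk _ ⟨F.tgt k, A (z : S.region (F.src k)) + F.trans k, F.mem_region z.1.2 z.2⟩ :
          S'.Surface) :=
      continuous_quot_mk.comp (continuous_sigmaMk.comp
        (Continuous.subtype_mk (by fun_prop) _))
    exact hc.congr fun z => (F.preMap_eq ⟨F.src k, z.1⟩ k rfl z.2).symm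

theorem isAffineMap : IsAffineMap A F.toFun where
  continuous := F.continuous_toFun
  map_conePoints := by
    rintro _ ⟨i, z, hz, hv, rfl⟩
    obtain ⟨k, hk, hzk, hkv⟩ := F.vertex i z hv hz
    exact ⟨_, _, _, hkv, F.toFun_point hz k hk hzk⟩
  straight := by
    intro i z v ε hε h
    have := F.finite
    -- Pigeonhole: with finitely many pieces, one of them is visited at arbitrarily small positive
    -- times. Since it is closed it contains the starting point, and since it is convex it contains
    -- an initial segment.
    have key : ∃ k, ∃ᶠ s : ℝ in 𝓝[>] 0, F.src k = i ∧ z + (s : ℂ) * v ∈ F.piece k := by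
      by_contra! H
      rw [← eventually_all] at H
      have hI : ∀ᶠ s in 𝓝[>] (0 : ℝ), s ∈ Set.Ioc 0 ε := Ioc_mem_nhdsGT hε
      obtain ⟨s, hs, hsI⟩ := (H.and hI).exists
      obtain ⟨k, hk⟩ := F.cover i _ (h s ⟨hsI.1.le, hsI.2⟩)
      exact hs k hk.1 hk.2
    obtain ⟨k, hk⟩ := key
    set T : Set ℝ := {s | z + (s : ℂ) * v ∈ F.piece k} with hT
    have hTc : IsClosed T := (F.isClosed_piece k).preimage (by fun_prop)
    have hTo : Convex ℝ T := by
      have hm : T = (AffineMap.lineMap z (z + v) : ℝ →ᵃ[ℝ] ℂ) ⁻¹' F.piece k := by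
        ext s
        simp [hT, AffineMap.lineMap_apply, add_comm]
      rw [hm]
      exact (F.convex_piece k).affine_preimage _
    have hT0 : (0 : ℝ) ∈ T := by
      rw [← hTc.closure_eq, mem_closure_iff_frequently]
      exact (hk.mono fun s hs => hs.2).filter_mono nhdsWithin_le_nhds
    obtain ⟨δ, ⟨hki, hδT⟩, hδ⟩ := (hk.and_eventually (Ioc_mem_nhdsGT hε)).exists
    refine ⟨F.tgt k, A z + F.trans k, δ, hδ.1, hδ.2, fun s hs hz => ?_⟩
    have hsT : s ∈ T := hTo.ordConnected.out hT0 hδT hs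
    have e : A (z + (s : ℂ) * v) + F.trans k = A z + F.trans k + (s : ℂ) * A v := by
      have : (s : ℂ) * v = s • v := rfl
      rw [this, map_add, map_smul, Complex.real_smul]; ring
    have h1 := F.toFun_point hz k hki hsT
    have h2 := F.mem_region (k := k) (by rw [hki]; exact hz) hsT
    exact ⟨e ▸ h2, h1.trans (Same.of_eq e h2).2.2⟩

/-- Two maps that are inverse to each other on pieces give an affine homeomorphism. -/
noncomputable def affineIso {B : ℂ →L[ℝ] ℂ} (G : CutPaste S' S B) (hBA : ∀ v, B (A v) = v)
    (hAB : ∀ v, A (B v) = v)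
    (h : ∀ k z, z ∈ S.region (F.src k) → z ∈ F.piece k → ∃ l, G.src l = F.tgt k ∧
      A z + F.trans k ∈ G.piece l ∧
      G.tgt l = F.src k ∧ B (A z + F.trans k) + G.trans l = z)
    (h' : ∀ k z, z ∈ S'.region (G.src k) → z ∈ G.piece k → ∃ l, F.src l = G.tgt k ∧
      B z + G.trans k ∈ F.piece l ∧
      F.tgt l = G.src k ∧ A (B z + G.trans k) + F.trans l = z) : AffineIso S S' A B where
  toHomeomorph :=
    { toFun := F.toFun
      invFun := G.toFun
      left_inv := by
        rintro ⟨i, z, hz⟩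
        obtain ⟨k, rfl, hzk⟩ := F.cover i z hz
        obtain ⟨l, hl, hzl, hlk, e⟩ := h k z hz hzk
        have h1 := F.toFun_point hz k rfl hzk
        have h2 := G.toFun_point (F.mem_region hz hzk) l hl hzl
        refine (congrArg G.toFun h1).trans (h2.trans ?_)
        simp only [e, hlk]
        rfl
      right_inv := by
        rintro ⟨i, z, hz⟩
        obtain ⟨k, rfl, hzk⟩ := G.cover i z hz
        obtain ⟨l, hl, hzl, hlk, e⟩ := h' k z hz hzk
        have h1 := G.toFun_point hz k rfl hzk
        have h2 := F.toFun_point (G.mem_region hz hzk) l hl hzl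
        refine (congrArg F.toFun h1).trans (h2.trans ?_)
        simp only [e, hlk]
        rfl
      continuous_toFun := F.continuous_toFun
      continuous_invFun := G.continuous_toFun }
  left_inv := hBA
  right_inv := hAB
  affine := F.isAffineMap
  affine_symm := G.isAffineMap

end CutPaste

end PolygonGluing

open PolygonGluing

/-! ### Plane geometry in coordinates -/

/-- The real linear map with columns `u` and `w`. -/
noncomputable def columnMap (u w : ℂ) : ℂ →L[ℝ] ℂ :=
  Complex.reCLM.smulRight u + Complex.imCLM.smulRight w

theorem columnMap_apply (a b c d x y : ℝ) :
    columnMap ⟨a, b⟩ ⟨c, d⟩ ⟨x, y⟩ = ⟨a * x + c * y, b * x + d * y⟩ := by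
  apply Complex.ext <;> simp [columnMap] <;> ring

theorem columnMap_add (a b c d e f x y : ℝ) :
    columnMap ⟨a, b⟩ ⟨c, d⟩ ⟨x, y⟩ + ⟨e, f⟩ = ⟨a * x + c * y + e, b * x + d * y + f⟩ := by
  rw [columnMap_apply]; rfl

theorem Complex.mk_add_mk (x y a b : ℝ) : (⟨x, y⟩ + ⟨a, b⟩ : ℂ) = ⟨x + a, y + b⟩ := rfl

/-- Reduces each gluing check below to four real equations between coordinates. -/
theorem PolygonGluing.Same.coord_congr {S : PolygonGluing} {i j : S.ι} {x y u w x' y' u' w' : ℝ}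
    (h : S.Same i ⟨x, y⟩ j ⟨u, w⟩) (hx : x' = x) (hy : y' = y) (hu : u' = u) (hw : w' = w) :
    S.Same i ⟨x', y'⟩ j ⟨u', w'⟩ := by
  subst hx hy hu hw; exact h

/-- The closed half-plane `α x + β y ≤ γ`. -/
def halfPlane (α β γ : ℝ) : Set ℂ := {z | α * z.re + β * z.im ≤ γ}

theorem mem_halfPlane {α β γ x y : ℝ} :
    (⟨x, y⟩ : ℂ) ∈ halfPlane α β γ ↔ α * x + β * y ≤ γ := Iff.rfl

theorem isClosed_halfPlane (α β γ : ℝ) : IsClosed (halfPlane α β γ) :=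
  isClosed_le (by fun_prop) (by fun_prop)

theorem convex_halfPlane (α β γ : ℝ) : Convex ℝ (halfPlane α β γ) := by
  have h := (convex_Iic γ).linear_preimage (α • Complex.reLm + β • Complex.imLm)
  exact h

theorem mem_segment_horizontal {p q c x y : ℝ} (h : p ≤ q) :
    (⟨x, y⟩ : ℂ) ∈ segment ℝ (⟨p, c⟩ : ℂ) ⟨q, c⟩ ↔ y = c ∧ p ≤ x ∧ x ≤ q := by
  have key := Set.ext_iff.1 (segment_eq_Icc h) x
  rw [Set.mem_Icc] at key
  rw [← key]
  constructor
  · rintro ⟨s, t, hs, ht, hst, e⟩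
    rw [Complex.ext_iff] at e
    simp at e
    exact ⟨by rw [← e.2, ← add_mul, hst, one_mul], s, t, hs, ht, hst, e.1⟩
  · rintro ⟨rfl, s, t, hs, ht, hst, e⟩
    refine ⟨s, t, hs, ht, hst, Complex.ext ?_ ?_⟩
    · simpa using e
    · simp [← add_mul, hst]

theorem mem_segment_vertical {p q c x y : ℝ} (h : p ≤ q) :
    (⟨x, y⟩ : ℂ) ∈ segment ℝ (⟨c, p⟩ : ℂ) ⟨c, q⟩ ↔ x = c ∧ p ≤ y ∧ y ≤ q := by
  have key := Set.ext_iff.1 (segment_eq_Icc h) y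
  rw [Set.mem_Icc] at key
  rw [← key]
  constructor
  · rintro ⟨s, t, hs, ht, hst, e⟩
    rw [Complex.ext_iff] at e
    simp at e
    exact ⟨by rw [← e.1, ← add_mul, hst, one_mul], s, t, hs, ht, hst, e.2⟩
  · rintro ⟨rfl, s, t, hs, ht, hst, e⟩
    refine ⟨s, t, hs, ht, hst, Complex.ext ?_ ?_⟩
    · simp [← add_mul, hst]
    · simpa using e

/-! ### The golden L in coordinates -/

theorem goldenRatio_mul_self : φ * φ = φ + 1 := by
  rw [← sq, Real.goldenRatio_sq]

theorem mem_goldenLRegion {x y : ℝ} : (⟨x, y⟩ : ℂ) ∈ goldenLRegion ↔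
    (0 ≤ x ∧ x ≤ φ + 1 ∧ 0 ≤ y ∧ y ≤ φ) ∨ (0 ≤ x ∧ x ≤ φ ∧ 0 ≤ y ∧ y ≤ φ + 1) := Iff.rfl

theorem goldenL_same_upper_sides {y : ℝ} (h : φ ≤ y) (h' : y ≤ φ + 1) :
    goldenL.Same () ⟨0, y⟩ () ⟨φ, y⟩ := by
  have h0 := Real.one_lt_goldenRatio
  have h1 : (⟨0, y⟩ : ℂ) ∈ goldenLRegion := mem_goldenLRegion.2 (by grind)
  have h2 : (⟨φ, y⟩ : ℂ) ∈ goldenLRegion := mem_goldenLRegion.2 (by grind)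
  have e : (⟨0, y⟩ + goldenL.shift (0 : Fin 4) : ℂ) = ⟨φ, y⟩ := by
    apply Complex.ext <;> simp [goldenL]
  have := Same.glue (S := goldenL) (0 : Fin 4) (z := ⟨0, y⟩)
    ((mem_segment_vertical (by linarith)).2 ⟨rfl, h, h'⟩) h1 (e ▸ h2)
  rwa [e] at this

theorem goldenL_same_lower_sides {y : ℝ} (h : 0 ≤ y) (h' : y ≤ φ) :
    goldenL.Same () ⟨0, y⟩ () ⟨φ + 1, y⟩ := by
  have h0 := Real.one_lt_goldenRatio
  have h1 : (⟨0, y⟩ : ℂ) ∈ goldenLRegion := mem_goldenLRegion.2 (by grind)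
  have h2 : (⟨φ + 1, y⟩ : ℂ) ∈ goldenLRegion := mem_goldenLRegion.2 (by grind)
  have e : (⟨0, y⟩ + goldenL.shift (1 : Fin 4) : ℂ) = ⟨φ + 1, y⟩ := by
    apply Complex.ext <;> simp [goldenL]
  have := Same.glue (S := goldenL) (1 : Fin 4) (z := ⟨0, y⟩)
    ((mem_segment_vertical (by linarith)).2 ⟨rfl, h, h'⟩) h1 (e ▸ h2)
  rwa [e] at this

theorem goldenL_same_left_sides {x : ℝ} (h : 0 ≤ x) (h' : x ≤ φ) :
    goldenL.Same () ⟨x, 0⟩ () ⟨x, φ + 1⟩ := by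
  have h0 := Real.one_lt_goldenRatio
  have h1 : (⟨x, 0⟩ : ℂ) ∈ goldenLRegion := mem_goldenLRegion.2 (by grind)
  have h2 : (⟨x, φ + 1⟩ : ℂ) ∈ goldenLRegion := mem_goldenLRegion.2 (by grind)
  have e : (⟨x, 0⟩ + goldenL.shift (2 : Fin 4) : ℂ) = ⟨x, φ + 1⟩ := by
    apply Complex.ext <;> simp [goldenL]
  have := Same.glue (S := goldenL) (2 : Fin 4) (z := ⟨x, 0⟩)
    ((mem_segment_horizontal (by linarith)).2 ⟨rfl, h, h'⟩) h1 (e ▸ h2)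
  rwa [e] at this

theorem goldenL_same_right_sides {x : ℝ} (h : φ ≤ x) (h' : x ≤ φ + 1) :
    goldenL.Same () ⟨x, 0⟩ () ⟨x, φ⟩ := by
  have h0 := Real.one_lt_goldenRatio
  have h1 : (⟨x, 0⟩ : ℂ) ∈ goldenLRegion := mem_goldenLRegion.2 (by grind)
  have h2 : (⟨x, φ⟩ : ℂ) ∈ goldenLRegion := mem_goldenLRegion.2 (by grind)
  have e : (⟨x, 0⟩ + goldenL.shift (3 : Fin 4) : ℂ) = ⟨x, φ⟩ := by
    apply Complex.ext <;> simp [goldenL]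
  have := Same.glue (S := goldenL) (3 : Fin 4) (z := ⟨x, 0⟩)
    ((mem_segment_horizontal (by linarith)).2 ⟨rfl, h, h'⟩) h1 (e ▸ h2)
  rwa [e] at this

/-- Cut-and-paste data on the golden L, in coordinates. -/
noncomputable def goldenLCutPaste (S' : PolygonGluing) (A : ℂ →L[ℝ] ℂ) (n : ℕ)
    (tgt : Fin n → S'.ι) (piece : Fin n → Set ℂ) (trans : Fin n → ℂ)
    (isClosed_piece : ∀ k, IsClosed (piece k)) (convex_piece : ∀ k, Convex ℝ (piece k))
    (cover : ∀ x y : ℝ, (⟨x, y⟩ : ℂ) ∈ goldenLRegion → ∃ k, (⟨x, y⟩ : ℂ) ∈ piece k)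
    (compat : ∀ k l, k ≤ l → ∀ x y : ℝ, (⟨x, y⟩ : ℂ) ∈ goldenLRegion → (⟨x, y⟩ : ℂ) ∈ piece k →
      (⟨x, y⟩ : ℂ) ∈ piece l →
      S'.Same (tgt k) (A ⟨x, y⟩ + trans k) (tgt l) (A ⟨x, y⟩ + trans l))
    (upper : ∀ y : ℝ, φ ≤ y → y ≤ φ + 1 → ∃ k l, (⟨0, y⟩ : ℂ) ∈ piece k ∧
      (⟨φ, y⟩ : ℂ) ∈ piece l ∧ S'.Same (tgt k) (A ⟨0, y⟩ + trans k) (tgt l) (A ⟨φ, y⟩ + trans l))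
    (lower : ∀ y : ℝ, 0 ≤ y → y ≤ φ → ∃ k l, (⟨0, y⟩ : ℂ) ∈ piece k ∧
      (⟨φ + 1, y⟩ : ℂ) ∈ piece l ∧
      S'.Same (tgt k) (A ⟨0, y⟩ + trans k) (tgt l) (A ⟨φ + 1, y⟩ + trans l))
    (left : ∀ x : ℝ, 0 ≤ x → x ≤ φ → ∃ k l, (⟨x, 0⟩ : ℂ) ∈ piece k ∧
      (⟨x, φ + 1⟩ : ℂ) ∈ piece l ∧
      S'.Same (tgt k) (A ⟨x, 0⟩ + trans k) (tgt l) (A ⟨x, φ + 1⟩ + trans l))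
    (right : ∀ x : ℝ, φ ≤ x → x ≤ φ + 1 → ∃ k l, (⟨x, 0⟩ : ℂ) ∈ piece k ∧
      (⟨x, φ⟩ : ℂ) ∈ piece l ∧ S'.Same (tgt k) (A ⟨x, 0⟩ + trans k) (tgt l) (A ⟨x, φ⟩ + trans l))
    (vertex : ∀ z ∈ goldenL.vertices (), ∃ k, z ∈ piece k ∧ A z + trans k ∈ S'.vertices (tgt k)) :
    CutPaste goldenL S' A where
  κ := Fin n
  finite := inferInstance
  src _ := ()
  tgt := tgt
  piece := piece
  trans := trans
  isClosed_piece := isClosed_piece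
  convex_piece := convex_piece
  cover := by
    rintro ⟨⟩ ⟨x, y⟩ hz
    obtain ⟨k, hk⟩ := cover x y hz
    exact ⟨k, rfl, hk⟩
  compat := by
    rintro k l ⟨x, y⟩ - hz hk hl
    rcases le_total k l with h | h
    · exact compat k l h x y hz hk hl
    · exact (compat l k h x y hz hl hk).symm
  glue := by
    rintro e ⟨x, y⟩ hs - -
    have h0 := Real.one_lt_goldenRatio
    have H : ∀ {u w : ℝ}, (∃ k l, (⟨x, y⟩ : ℂ) ∈ piece k ∧ (⟨u, w⟩ : ℂ) ∈ piece l ∧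
        S'.Same (tgt k) (A ⟨x, y⟩ + trans k) (tgt l) (A ⟨u, w⟩ + trans l)) →
        (⟨x, y⟩ + goldenL.shift e : ℂ) = ⟨u, w⟩ →
        ∃ k l, () = goldenL.src e ∧ () = goldenL.tgt e ∧
      (⟨x, y⟩ : ℂ) ∈ piece k ∧ ⟨x, y⟩ + goldenL.shift e ∈ piece l ∧
      S'.Same (tgt k) (A ⟨x, y⟩ + trans k) (tgt l) (A (⟨x, y⟩ + goldenL.shift e) + trans l) := by
      rintro u w ⟨k, l, h1, h2, h3⟩ e
      rw [e]
      exact ⟨k, l, rfl, rfl, h1, h2, h3⟩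
    change Fin 4 at e
    fin_cases e
    · obtain ⟨rfl, h1, h2⟩ := (mem_segment_vertical (by linarith)).1 hs
      exact H (upper y h1 h2) (by apply Complex.ext <;> simp [goldenL])
    · obtain ⟨rfl, h1, h2⟩ := (mem_segment_vertical (by linarith)).1 hs
      exact H (lower y h1 h2) (by apply Complex.ext <;> simp [goldenL])
    · obtain ⟨rfl, h1, h2⟩ := (mem_segment_horizontal (by linarith)).1 hs
      exact H (left x h1 h2) (by apply Complex.ext <;> simp [goldenL])
    · obtain ⟨rfl, h1, h2⟩ := (mem_segment_horizontal (by linarith)).1 hs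
      exact H (right x h1 h2) (by apply Complex.ext <;> simp [goldenL])
  vertex := by
    rintro ⟨⟩ z hz -
    obtain ⟨k, h⟩ := vertex z hz
    exact ⟨k, rfl, h⟩

theorem goldenL_forall_vertices {p : ℂ → Prop} : (∀ z ∈ goldenL.vertices (), p z) ↔
    p ⟨0, 0⟩ ∧ p ⟨φ, 0⟩ ∧ p ⟨φ + 1, 0⟩ ∧ p ⟨φ + 1, φ⟩ ∧ p ⟨φ, φ⟩ ∧ p ⟨φ, φ + 1⟩ ∧ p ⟨0, φ + 1⟩ ∧
      p ⟨0, φ⟩ := by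
  simp only [goldenL, Set.mem_insert_iff, Set.mem_singleton_iff, forall_eq_or_imp, forall_eq]
  rfl

theorem mk_mem_goldenL_vertices {x y : ℝ} : (⟨x, y⟩ : ℂ) ∈ goldenL.vertices () ↔
    x = 0 ∧ y = 0 ∨ x = φ ∧ y = 0 ∨ x = φ + 1 ∧ y = 0 ∨ x = φ + 1 ∧ y = φ ∨ x = φ ∧ y = φ ∨
      x = φ ∧ y = φ + 1 ∨ x = 0 ∧ y = φ + 1 ∨ x = 0 ∧ y = φ := by
  simp only [goldenL, Set.mem_insert_iff, Set.mem_singleton_iff, Complex.ext_iff, Complex.zero_re,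
    Complex.zero_im]

/-- The reflection of the golden L in the diagonal. -/
noncomputable def goldenLDiagCutPaste : CutPaste goldenL goldenL (columnMap ⟨0, 1⟩ ⟨1, 0⟩) :=
  goldenLCutPaste goldenL _ 1 (fun _ => ()) (fun _ => Set.univ) (fun _ => ⟨0, 0⟩)
    (fun _ => isClosed_univ) (fun _ => convex_univ) (fun _ _ _ => ⟨0, trivial⟩)
    (by
      intro _ _ _ x y hz _ _
      rw [columnMap_add]
      exact .refl (mem_goldenLRegion.2 (by rw [mem_goldenLRegion] at hz; grind)))
    -- The reflection exchanges the pair of upper sides with the right pair, and the pair of lower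
    -- sides with the left pair; the four checks follow this pattern.
    (by
      intro y h h'
      simp only [columnMap_add]
      exact ⟨0, 0, trivial, trivial,
        (goldenL_same_right_sides h h').coord_congr (by ring) (by ring) (by ring) (by ring)⟩)
    (by
      intro y h h'
      simp only [columnMap_add]
      exact ⟨0, 0, trivial, trivial,
        (goldenL_same_left_sides h h').coord_congr (by ring) (by ring) (by ring) (by ring)⟩)
    (by
      intro y h h'
      simp only [columnMap_add]
      exact ⟨0, 0, trivial, trivial,
        (goldenL_same_lower_sides h h').coord_congr (by ring) (by ring) (by ring) (by ring)⟩)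
    (by
      intro y h h'
      simp only [columnMap_add]
      exact ⟨0, 0, trivial, trivial,
        (goldenL_same_upper_sides h h').coord_congr (by ring) (by ring) (by ring) (by ring)⟩)
    (by
      rw [goldenL_forall_vertices]
      simp only [columnMap_add, mk_mem_goldenL_vertices]
      refine ⟨?_, ?_, ?_, ?_, ?_, ?_, ?_, ?_⟩ <;> exact ⟨0, trivial, by simp⟩)

/-- A cut-and-paste map of the golden L that is an involution gives an affine homeomorphism. -/
noncomputable def involutionIso {A : ℂ →L[ℝ] ℂ} (F : CutPaste goldenL goldenL A)
    (hA : ∀ x y : ℝ, A (A ⟨x, y⟩) = ⟨x, y⟩)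
    (h : ∀ k, ∀ x y : ℝ, (⟨x, y⟩ : ℂ) ∈ goldenLRegion → (⟨x, y⟩ : ℂ) ∈ F.piece k →
      ∃ l, A ⟨x, y⟩ + F.trans k ∈ F.piece l ∧ A (A ⟨x, y⟩ + F.trans k) + F.trans l = ⟨x, y⟩) :
    AffineIso goldenL goldenL A A :=
  have h' : ∀ k, ∀ z ∈ goldenL.region (F.src k), z ∈ F.piece k → ∃ l, F.src l = F.tgt k ∧
      A z + F.trans k ∈ F.piece l ∧ F.tgt l = F.src k ∧ A (A z + F.trans k) + F.trans l = z := by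
    rintro k ⟨x, y⟩ hz hk
    obtain ⟨l, h1, h2⟩ := h k x y hz hk
    exact ⟨l, rfl, h1, rfl, h2⟩
  F.affineIso F (fun v => hA v.re v.im) (fun v => hA v.re v.im) h' h'

/-- The diagonal reflection as an affine homeomorphism of the golden L. -/
noncomputable def goldenLDiag :
    AffineIso goldenL goldenL (columnMap ⟨0, 1⟩ ⟨1, 0⟩) (columnMap ⟨0, 1⟩ ⟨1, 0⟩) :=
  involutionIso goldenLDiagCutPaste
    (by intro x y; simp [columnMap_apply])
    (by
      intro k x y _ _
      refine ⟨(0 : Fin 1), trivial, ?_⟩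
      change columnMap ⟨0, 1⟩ ⟨1, 0⟩ (columnMap ⟨0, 1⟩ ⟨1, 0⟩ ⟨x, y⟩ + ⟨0, 0⟩) + ⟨0, 0⟩ = _
      simp [columnMap_add])

/-- The vertical reflection of each of the two horizontal cylinders of the golden L. -/
noncomputable def goldenLConjCutPaste : CutPaste goldenL goldenL (columnMap ⟨1, 0⟩ ⟨0, -1⟩) :=
  goldenLCutPaste goldenL _ 2 (fun _ => ())
    -- The pieces are the two horizontal cylinders; the translations make their core curves `y = φ /
    -- 2` and `y = φ + 1 / 2` the mirrors.
    ![halfPlane 0 1 φ, halfPlane 1 0 φ ∩ halfPlane 0 (-1) (-φ)]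
    ![⟨0, φ⟩, ⟨0, 2 * φ + 1⟩]
    (by
      rw [Fin.forall_fin_two]
      exact ⟨isClosed_halfPlane _ _ _, (isClosed_halfPlane _ _ _).inter (isClosed_halfPlane _ _ _)⟩)
    (by
      rw [Fin.forall_fin_two]
      exact ⟨convex_halfPlane _ _ _, (convex_halfPlane _ _ _).inter (convex_halfPlane _ _ _)⟩)
    (by
      intro x y h
      simp only [Fin.exists_fin_two, Matrix.cons_val, Set.mem_inter_iff, mem_halfPlane]
      rw [mem_goldenLRegion] at h
      grind)
    (by
      intro k l hkl x y hz hk hl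
      have h0 := Real.one_lt_goldenRatio
      rw [mem_goldenLRegion] at hz
      fin_cases k <;> fin_cases l <;>
        simp [Set.mem_inter_iff, mem_halfPlane, columnMap_add] at hkl hk hl ⊢
      · exact .refl (mem_goldenLRegion.2 (by grind))
      -- On the common boundary `y = φ` one piece maps to the bottom side and the other to the top
      -- side of the L, which are glued.
      · exact (goldenL_same_left_sides (x := x) (by grind) (by grind)).coord_congr
          (by grind) (by grind) (by grind) (by grind)
      · exact .refl (mem_goldenLRegion.2 (by grind)))
    (by
      intro y h h'
      have h0 := Real.one_lt_goldenRatio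
      refine ⟨1, 1, ?_⟩
      simp only [columnMap_add, mem_halfPlane, Matrix.cons_val, Set.mem_inter_iff]
      exact ⟨by grind, by grind, (goldenL_same_upper_sides (y := 2 * φ + 1 - y) (by grind)
        (by grind)).coord_congr (by ring) (by ring) (by ring) (by ring)⟩)
    (by
      intro y h h'
      refine ⟨0, 0, ?_⟩
      simp only [columnMap_add, mem_halfPlane, Matrix.cons_val]
      exact ⟨by grind, by grind, (goldenL_same_lower_sides (y := φ - y) (by grind)
        (by grind)).coord_congr (by ring) (by ring) (by ring) (by ring)⟩)
    (by
      intro x h h'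
      refine ⟨0, 1, ?_⟩
      simp only [columnMap_add, mem_halfPlane, Matrix.cons_val, Set.mem_inter_iff]
      exact ⟨by grind, by grind, (Same.refl (S := goldenL) (i := ()) (z := ⟨x, φ⟩)
        (mem_goldenLRegion.2 (by grind))).coord_congr (by ring) (by ring) (by ring) (by ring)⟩)
    (by
      intro x h h'
      have h0 := Real.one_lt_goldenRatio
      refine ⟨0, 0, ?_⟩
      simp only [columnMap_add, mem_halfPlane, Matrix.cons_val]
      exact ⟨by grind, by grind, (goldenL_same_right_sides (x := x) (by grind)
        (by grind)).symm.coord_congr (by ring) (by ring) (by ring) (by ring)⟩)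
    (by
      have h0 := Real.one_lt_goldenRatio
      rw [goldenL_forall_vertices]
      simp only [Fin.exists_fin_two, Matrix.cons_val, columnMap_add, mk_mem_goldenL_vertices,
        mem_halfPlane, Set.mem_inter_iff]
      refine ⟨?_, ?_, ?_, ?_, ?_, ?_, ?_, ?_⟩ <;> grind)

/-- The vertical reflection of the cylinders as an affine homeomorphism of the golden L. -/
noncomputable def goldenLConj :
    AffineIso goldenL goldenL (columnMap ⟨1, 0⟩ ⟨0, -1⟩) (columnMap ⟨1, 0⟩ ⟨0, -1⟩) :=
  involutionIso goldenLConjCutPaste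
    (by intro x y; simp [columnMap_apply])
    (by
      intro k x y hz hk
      have h0 := Real.one_lt_goldenRatio
      rw [mem_goldenLRegion] at hz
      simp only [goldenLConjCutPaste, goldenLCutPaste] at hk ⊢
      change Fin 2 at k
      fin_cases k <;> [refine ⟨0, ?_⟩; refine ⟨1, ?_⟩] <;>
        simp [Set.mem_inter_iff, mem_halfPlane, columnMap_add] at hk ⊢ <;> grind)

/-- An affine involution of the golden L that reverses the orientation and exchanges the two
boundary circles of each of the two horizontal cylinders. -/
noncomputable def goldenLTwistCutPaste : CutPaste goldenL goldenL (columnMap ⟨1, 0⟩ ⟨-φ, -1⟩) :=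
  goldenLCutPaste goldenL _ 4 (fun _ => ())
    -- The shear moves points of a cylinder to the left by at most one circumference. Each cylinder
    -- is cut along the slanted line where the image crosses `x = 0`; the translations of its two
    -- pieces differ by the circumference, `φ + 1` below and `φ` above.
    ![halfPlane 0 1 φ ∩ halfPlane (-1) φ 0,
      halfPlane 0 1 φ ∩ halfPlane 1 (-φ) 0,
      halfPlane 1 0 φ ∩ halfPlane 0 (-1) (-φ) ∩ halfPlane (-1) φ (φ + 1),
      halfPlane 1 0 φ ∩ halfPlane 0 (-1) (-φ) ∩ halfPlane 1 (-φ) (-φ - 1)]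
    ![⟨0, φ⟩, ⟨φ + 1, φ⟩, ⟨φ + 1, 2 * φ + 1⟩, ⟨2 * φ + 1, 2 * φ + 1⟩]
    (by
      intro k
      fin_cases k
      · exact (isClosed_halfPlane _ _ _).inter (isClosed_halfPlane _ _ _)
      · exact (isClosed_halfPlane _ _ _).inter (isClosed_halfPlane _ _ _)
      · exact ((isClosed_halfPlane _ _ _).inter (isClosed_halfPlane _ _ _)).inter
          (isClosed_halfPlane _ _ _)
      · exact ((isClosed_halfPlane _ _ _).inter (isClosed_halfPlane _ _ _)).inter
          (isClosed_halfPlane _ _ _))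
    (by
      intro k
      fin_cases k
      · exact (convex_halfPlane _ _ _).inter (convex_halfPlane _ _ _)
      · exact (convex_halfPlane _ _ _).inter (convex_halfPlane _ _ _)
      · exact ((convex_halfPlane _ _ _).inter (convex_halfPlane _ _ _)).inter
          (convex_halfPlane _ _ _)
      · exact ((convex_halfPlane _ _ _).inter (convex_halfPlane _ _ _)).inter
          (convex_halfPlane _ _ _))
    (by
      intro x y h
      rw [mem_goldenLRegion] at h
      rcases le_or_gt y φ with h1 | h1
      · rcases le_total (φ * y) x with h2 | h2
        · exact ⟨0, by simp [mem_halfPlane]; grind⟩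
        · exact ⟨1, by simp [mem_halfPlane]; grind⟩
      · rcases le_total (φ * y) (x + φ + 1) with h2 | h2
        · exact ⟨2, by simp [mem_halfPlane]; grind⟩
        · exact ⟨3, by simp [mem_halfPlane]; grind⟩)
    (by
      intro k l hkl x y hz hk hl
      have h0 := Real.one_lt_goldenRatio
      have hφ := goldenRatio_mul_self
      have h1 : 0 ≤ φ * y := mul_nonneg (by linarith) (by rw [mem_goldenLRegion] at hz; grind)
      have h2 : y ≤ φ → φ * y ≤ φ * φ := fun h => mul_le_mul_of_nonneg_left h (by linarith)
      have h3 : φ ≤ y → φ * φ ≤ φ * y := fun h => mul_le_mul_of_nonneg_left h (by linarith)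
      have h4 : y ≤ φ + 1 → φ * y ≤ φ * (φ + 1) :=
        fun h => mul_le_mul_of_nonneg_left h (by linarith)
      rw [mem_goldenLRegion] at hz
      fin_cases k <;> fin_cases l <;>
        simp [Set.mem_inter_iff, mem_halfPlane, columnMap_add] at hkl hk hl ⊢
      · exact .refl (mem_goldenLRegion.2 (by grind))
      · exact (goldenL_same_lower_sides (y := φ - y) (by grind) (by grind)).coord_congr
          (by grind) (by grind) (by grind) (by grind)
      · exact (goldenL_same_left_sides (x := x) (by grind) (by grind)).coord_congr
          (by grind) (by grind) (by grind) (by grind)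
      -- Pieces 0 and 3 are disjoint: a common point would have `y = φ`, hence `φ + 1 ≤ x ≤ φ`.
      · grind
      · exact .refl (mem_goldenLRegion.2 (by grind))
      · exact (goldenL_same_left_sides (x := x) (by grind) (by grind)).coord_congr
          (by grind) (by grind) (by grind) (by grind)
      -- Pieces 1 and 3 meet only at the corner `(0, φ)`; its two images `(0, 0)` and `(φ, φ + 1)`
      -- are identified through `(0, φ + 1)`.
      · exact ((goldenL_same_left_sides (x := 0) (by grind) (by grind)).trans
          (goldenL_same_upper_sides (by grind) (by grind))).coord_congr
          (by grind) (by grind) (by grind) (by grind)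
      · exact .refl (mem_goldenLRegion.2 (by grind))
      · exact (goldenL_same_upper_sides (y := 2 * φ + 1 - y) (by grind) (by grind)).coord_congr
          (by grind) (by grind) (by grind) (by grind)
      · exact .refl (mem_goldenLRegion.2 (by grind)))
    (by
      intro y h h'
      have h0 := Real.one_lt_goldenRatio
      have hφ := goldenRatio_mul_self
      have h3 : φ * φ ≤ φ * y := mul_le_mul_of_nonneg_left h (by linarith)
      have h4 : φ * y ≤ φ * (φ + 1) := mul_le_mul_of_nonneg_left h' (by linarith)
      refine ⟨3, 2, ?_⟩
      simp only [columnMap_add, mem_halfPlane, Matrix.cons_val, Set.mem_inter_iff]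
      exact ⟨by grind, by grind, (Same.refl (S := goldenL) (i := ())
        (z := ⟨2 * φ + 1 - φ * y, 2 * φ + 1 - y⟩) (mem_goldenLRegion.2 (by grind))).coord_congr
        (by ring) (by ring) (by ring) (by ring)⟩)
    (by
      intro y h h'
      have h0 := Real.one_lt_goldenRatio
      have hφ := goldenRatio_mul_self
      have h3 : φ * 0 ≤ φ * y := mul_le_mul_of_nonneg_left h (by linarith)
      have h4 : φ * y ≤ φ * φ := mul_le_mul_of_nonneg_left h' (by linarith)
      refine ⟨1, 0, ?_⟩
      simp only [columnMap_add, mem_halfPlane, Matrix.cons_val, Set.mem_inter_iff]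
      exact ⟨by grind, by grind, (Same.refl (S := goldenL) (i := ())
        (z := ⟨φ + 1 - φ * y, φ - y⟩) (mem_goldenLRegion.2 (by grind))).coord_congr
        (by ring) (by ring) (by ring) (by ring)⟩)
    (by
      intro x h h'
      have h0 := Real.one_lt_goldenRatio
      have hφ := goldenRatio_mul_self
      refine ⟨0, 3, ?_⟩
      simp only [columnMap_add, mem_halfPlane, Matrix.cons_val, Set.mem_inter_iff]
      exact ⟨by grind, by grind, (Same.refl (S := goldenL) (i := ()) (z := ⟨x, φ⟩)
        (mem_goldenLRegion.2 (by grind))).coord_congr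
        (by grind) (by grind) (by grind) (by grind)⟩)
    (by
      intro x h h'
      have h0 := Real.one_lt_goldenRatio
      have hφ := goldenRatio_mul_self
      refine ⟨0, 1, ?_⟩
      simp only [columnMap_add, mem_halfPlane, Matrix.cons_val, Set.mem_inter_iff]
      exact ⟨by grind, by grind, (goldenL_same_right_sides (x := x) (by grind)
        (by grind)).symm.coord_congr (by grind) (by grind) (by grind) (by grind)⟩)
    (by
      have h0 := Real.one_lt_goldenRatio
      have hφ := goldenRatio_mul_self
      rw [goldenL_forall_vertices]
      refine ⟨⟨0, ?_⟩, ⟨0, ?_⟩, ⟨0, ?_⟩, ⟨1, ?_⟩, ⟨1, ?_⟩, ⟨2, ?_⟩, ⟨3, ?_⟩, ⟨1, ?_⟩⟩ <;>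
        simp only [Matrix.cons_val, Set.mem_inter_iff, mem_halfPlane, columnMap_add,
          mk_mem_goldenL_vertices] <;> grind)

/-- The twisted reflection as an affine homeomorphism of the golden L. -/
noncomputable def goldenLTwist :
    AffineIso goldenL goldenL (columnMap ⟨1, 0⟩ ⟨-φ, -1⟩) (columnMap ⟨1, 0⟩ ⟨-φ, -1⟩) :=
  involutionIso goldenLTwistCutPaste
    (by intro x y; simp [columnMap_apply])
    (by
      intro k x y hz hk
      have h0 := Real.one_lt_goldenRatio
      have hφ := goldenRatio_mul_self
      have h2 : y ≤ φ → φ * y ≤ φ * φ := fun h => mul_le_mul_of_nonneg_left h (by linarith)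
      have h3 : φ ≤ y → φ * φ ≤ φ * y := fun h => mul_le_mul_of_nonneg_left h (by linarith)
      rw [mem_goldenLRegion] at hz
      simp only [goldenLTwistCutPaste, goldenLCutPaste] at hk ⊢
      change Fin 4 at k
      -- The involution exchanges the two pieces of each cylinder.
      fin_cases k <;> [refine ⟨1, ?_⟩; refine ⟨0, ?_⟩; refine ⟨3, ?_⟩; refine ⟨2, ?_⟩] <;>
        simp [Set.mem_inter_iff, mem_halfPlane, columnMap_add] at hk ⊢ <;> grind)

/-! ### The action on the Weierstrass points of the golden L -/

theorem toFun_goldenLMidpoint {S' : PolygonGluing} {A : ℂ →L[ℝ] ℂ} (F : CutPaste goldenL S' A)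
    (J : Label) (k : F.κ) (hk : goldenLMidpointCoord J ∈ F.piece k) {i : S'.ι} {w : ℂ}
    (hw : w ∈ S'.region i) (h : S'.Same (F.tgt k) (A (goldenLMidpointCoord J) + F.trans k) i w) :
    F.toFun (goldenLMidpoint J) = S'.point i w hw :=
  F.toFun_eq_of_same _ k rfl hk _ h

/-- The permutation of the Weierstrass points by the diagonal reflection of the golden L. -/
def diagPerm : Equiv.Perm Label := Equiv.swap .p1 .p5 * Equiv.swap .p2 .p4

theorem goldenLDiag_midpoint (J : Label) :
    goldenLDiag.toHomeomorph (goldenLMidpoint J) = goldenLMidpoint (diagPerm J) := by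
  refine toFun_goldenLMidpoint goldenLDiagCutPaste J (0 : Fin 1) trivial
    (goldenLMidpointCoord_mem _) (Same.symm (Same.of_eq ?_ (goldenLMidpointCoord_mem _)))
  change _ = columnMap ⟨0, 1⟩ ⟨1, 0⟩ _ + ⟨0, 0⟩
  cases J <;> simp only [goldenLMidpointCoord, columnMap_add]
  · change goldenLMidpointCoord .p5 = _
    simp [goldenLMidpointCoord]
  · change goldenLMidpointCoord .p4 = _
    simp [goldenLMidpointCoord]
  · change goldenLMidpointCoord .p3 = _
    simp [goldenLMidpointCoord]
  · change goldenLMidpointCoord .p2 = _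
    simp [goldenLMidpointCoord]
  · change goldenLMidpointCoord .p1 = _
    simp [goldenLMidpointCoord]

/-- Points 1 to 4 lie on the core curves, hence on the mirrors. Point 5 lies on the bottom side and
goes to the point above it on `y = φ`, which is glued to it. -/
theorem goldenLConj_midpoint (J : Label) :
    goldenLConj.toHomeomorph (goldenLMidpoint J) = goldenLMidpoint J := by
  have h0 := Real.one_lt_goldenRatio
  have key : ∃ k : Fin 2, goldenLMidpointCoord J ∈ goldenLConjCutPaste.piece k ∧
      goldenL.Same () (columnMap ⟨1, 0⟩ ⟨0, -1⟩ (goldenLMidpointCoord J) +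
        goldenLConjCutPaste.trans k) () (goldenLMidpointCoord J) := by
    have hJ := goldenLMidpointCoord_mem J
    simp only [goldenLConjCutPaste, goldenLCutPaste]
    cases J <;> [refine ⟨1, ?_, ?_⟩; refine ⟨1, ?_, ?_⟩; refine ⟨0, ?_, ?_⟩; refine ⟨0, ?_, ?_⟩;
      refine ⟨0, ?_, ?_⟩] <;> simp only [goldenLMidpointCoord] at hJ ⊢ <;>
      simp only [columnMap_add, mem_halfPlane, Matrix.cons_val, Set.mem_inter_iff]
    · grind
    · exact (Same.refl (S := goldenL) (i := ()) hJ).coord_congr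
        (by ring) (by ring) (by ring) (by ring)
    · grind
    · exact (Same.refl (S := goldenL) (i := ()) hJ).coord_congr
        (by ring) (by ring) (by ring) (by ring)
    · grind
    · exact (Same.refl (S := goldenL) (i := ()) hJ).coord_congr
        (by ring) (by ring) (by ring) (by ring)
    · grind
    · exact (Same.refl (S := goldenL) (i := ()) hJ).coord_congr
        (by ring) (by ring) (by ring) (by ring)
    · grind
    · exact (goldenL_same_right_sides (x := φ + 1 / 2) (by linarith)
        (by linarith)).symm.coord_congr (by ring) (by ring) (by ring) (by ring)
  obtain ⟨k, hk, h⟩ := key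
  exact toFun_goldenLMidpoint goldenLConjCutPaste J k hk (goldenLMidpointCoord_mem _) h

theorem goldenLTwist_midpoint (J : Label) :
    goldenLTwist.toHomeomorph (goldenLMidpoint J) = goldenLMidpoint (labelPerm 0 J) := by
  have h0 := Real.one_lt_goldenRatio
  have hφ := goldenRatio_mul_self
  have key : ∃ k : Fin 4, goldenLMidpointCoord J ∈ goldenLTwistCutPaste.piece k ∧
      goldenL.Same () (columnMap ⟨1, 0⟩ ⟨-φ, -1⟩ (goldenLMidpointCoord J) +
        goldenLTwistCutPaste.trans k) () (goldenLMidpointCoord (labelPerm 0 J)) := by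
    have hJ := goldenLMidpointCoord_mem (labelPerm 0 J)
    have e1 : labelPerm 0 .p1 = .p2 := by decide
    have e2 : labelPerm 0 .p2 = .p1 := by decide
    have e3 : labelPerm 0 .p3 = .p4 := by decide
    have e4 : labelPerm 0 .p4 = .p3 := by decide
    have e5 : labelPerm 0 .p5 = .p5 := by decide
    simp only [goldenLTwistCutPaste, goldenLCutPaste]
    cases J <;> simp only [e1, e2, e3, e4, e5, goldenLMidpointCoord] at hJ ⊢ <;>
      [refine ⟨3, ?_, ?_⟩; refine ⟨2, ?_, ?_⟩; refine ⟨1, ?_, ?_⟩; refine ⟨0, ?_, ?_⟩;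
      refine ⟨0, ?_, ?_⟩] <;>
      simp only [columnMap_add, mem_halfPlane, Matrix.cons_val, Set.mem_inter_iff]
    · grind
    · exact (Same.refl (S := goldenL) (i := ()) hJ).coord_congr
        (by grind) (by grind) (by grind) (by grind)
    · grind
    · exact (Same.refl (S := goldenL) (i := ()) hJ).coord_congr
        (by grind) (by grind) (by grind) (by grind)
    · grind
    · exact (Same.refl (S := goldenL) (i := ()) hJ).coord_congr
        (by grind) (by grind) (by grind) (by grind)
    · grind
    · exact (Same.refl (S := goldenL) (i := ()) hJ).coord_congr
        (by grind) (by grind) (by grind) (by grind)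
    · grind
    · exact (goldenL_same_right_sides (x := φ + 1 / 2) (by linarith)
        (by linarith)).symm.coord_congr (by ring) (by ring) (by ring) (by ring)
  obtain ⟨k, hk, h⟩ := key
  exact toFun_goldenLMidpoint goldenLTwistCutPaste J k hk (goldenLMidpointCoord_mem _) h

/-- The Weierstrass point `J` of the golden L has the same position in the direction `(x, y)` as
the Weierstrass point `K` in the direction `(u, w)`. -/
def SameWeierstrass (x y : ℝ) (J : Label) (u w : ℝ) (K : Label) : Prop :=
  SamePosition goldenL ⟨x, y⟩ (goldenLMidpoint J) goldenL ⟨u, w⟩ (goldenLMidpoint K)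

theorem SameWeierstrass.coord_congr {x y u w x' y' : ℝ} {J K L : Label}
    (h : SameWeierstrass x y J u w K) (hx : x' = x) (hy : y' = y) (hL : L = K) :
    SameWeierstrass x' y' J u w L := by
  subst hx hy hL; exact h

theorem SameWeierstrass.trans {x y u w r s : ℝ} {J K L : Label}
    (h : SameWeierstrass x y J u w K) (h' : SameWeierstrass u w K r s L) :
    SameWeierstrass x y J r s L :=
  SamePosition.trans h h'

theorem sameWeierstrass_diag (x y : ℝ) (J : Label) :
    SameWeierstrass y x J x y (diagPerm J) := by
  have h := goldenLDiag.samePosition ⟨x, y⟩ (goldenLMidpoint (diagPerm J))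
  have e : diagPerm (diagPerm J) = J := by clear h; revert J; decide
  rw [goldenLDiag_midpoint, columnMap_apply, e] at h
  exact SameWeierstrass.coord_congr h (by ring) (by ring) rfl

theorem sameWeierstrass_conj (x y : ℝ) (J : Label) : SameWeierstrass x (-y) J x y J := by
  have h := goldenLConj.samePosition ⟨x, y⟩ (goldenLMidpoint J)
  rw [goldenLConj_midpoint, columnMap_apply] at h
  exact SameWeierstrass.coord_congr h (by ring) (by ring) rfl

theorem labelPerm_mul_self (k : Fin 4) : labelPerm k * labelPerm k = 1 := by
  revert k; decide

theorem sameWeierstrass_twist (x y : ℝ) (J : Label) :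
    SameWeierstrass (x - φ * y) (-y) J x y (labelPerm 0 J) := by
  have h := goldenLTwist.samePosition ⟨x, y⟩ (goldenLMidpoint (labelPerm 0 J))
  have e : labelPerm 0 (labelPerm 0 J) = J := by
    rw [← Equiv.Perm.mul_apply, labelPerm_mul_self, Equiv.Perm.one_apply]
  rw [goldenLTwist_midpoint, columnMap_apply, e] at h
  exact SameWeierstrass.coord_congr h (by ring) (by ring) rfl

/-- `σ₀ = T R` on directions, and `R` fixes every Weierstrass point, so `T` alone contributes `τ₀`.
-/
theorem sameWeierstrass_zero (x y : ℝ) (J : Label) :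
    SameWeierstrass (x + φ * y) y J x y (labelPerm 0 J) :=
  ((sameWeierstrass_twist x (-y) J).trans (sameWeierstrass_conj x y _)).coord_congr
    (by ring) (by ring) rfl

/-- `σ₁ = σ₀ D R σ₀`, the upper right entry being `φ² - 1 = φ`. On labels this reads `τ₁ = τ₀ δ τ₀`,
with `δ` the permutation `diagPerm`. -/
theorem sameWeierstrass_one (x y : ℝ) (J : Label) :
    SameWeierstrass (φ * x + φ * y) (x + φ * y) J x y (labelPerm 1 J) :=
  ((((sameWeierstrass_zero (-y) (x + φ * y) J).trans (sameWeierstrass_diag _ _ _)).trans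
    (sameWeierstrass_conj _ _ _)).trans (sameWeierstrass_zero x y _)).coord_congr
    (by linear_combination (-y) * goldenRatio_mul_self) rfl (by revert J; decide)

/-- Conjugation by the diagonal reflection: `σ₂ = D σ₁ D` and `τ₂ = δ τ₁ δ`. The next lemma obtains
`σ₃` and `τ₃` from `σ₀` and `τ₀` in the same way. -/
theorem sameWeierstrass_two (x y : ℝ) (J : Label) :
    SameWeierstrass (φ * x + y) (φ * x + φ * y) J x y (labelPerm 2 J) :=
  (((sameWeierstrass_diag _ _ _).trans (sameWeierstrass_one y x _)).trans
    (sameWeierstrass_diag _ _ _)).coord_congr (by ring) (by ring) (by revert J; decide)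

theorem sameWeierstrass_three (x y : ℝ) (J : Label) :
    SameWeierstrass x (φ * x + y) J x y (labelPerm 3 J) :=
  (((sameWeierstrass_diag _ _ _).trans (sameWeierstrass_zero y x _)).trans
    (sameWeierstrass_diag _ _ _)).coord_congr (by ring) (by ring) (by revert J; decide)

/-! ### Tree words -/

theorem sameWeierstrass_veechGen (k : Fin 4) (v : Fin 2 → ℝ) (J : Label) :
    SameWeierstrass ((veechGen k).mulVec v 0) ((veechGen k).mulVec v 1) J (v 0) (v 1)
      (labelPerm k J) := by
  fin_cases k
  · exact (sameWeierstrass_zero (v 0) (v 1) J).coord_congr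
      (by simp [veechGen, Matrix.mulVec, dotProduct])
      (by simp [veechGen, Matrix.mulVec, dotProduct]) rfl
  · exact (sameWeierstrass_one (v 0) (v 1) J).coord_congr
      (by simp [veechGen, Matrix.mulVec, dotProduct])
      (by simp [veechGen, Matrix.mulVec, dotProduct]) rfl
  · exact (sameWeierstrass_two (v 0) (v 1) J).coord_congr
      (by simp [veechGen, Matrix.mulVec, dotProduct])
      (by simp [veechGen, Matrix.mulVec, dotProduct]) rfl
  · exact (sameWeierstrass_three (v 0) (v 1) J).coord_congr
      (by simp [veechGen, Matrix.mulVec, dotProduct])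
      (by simp [veechGen, Matrix.mulVec, dotProduct]) rfl

/-- Induction from the right end: the last letter gives the outermost matrix of `v_a` and the first
factor of `τ_a` to act, so peeling it off removes one matrix and applies one `τ_k` to `J`. -/
theorem samePosition_wordPerm (a : TreeWord) (J : Label) :
    SamePosition goldenL (goldenLDirection a) (goldenLMidpoint J) goldenL (goldenLDirection [])
      (goldenLMidpoint (wordPerm a J)) := by
  induction a using List.reverseRecOn generalizing J with
  | nil => exact ⟨.rfl, .rfl, .rfl⟩
  | append_singleton a k ih =>
    have h1 : wordVector (a ++ [k]) = (veechGen k).mulVec (wordVector a) := by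
      simp [wordVector]
    have h2 : wordPerm (a ++ [k]) J = wordPerm a (labelPerm k J) := by
      simp [wordPerm]
    have h3 := sameWeierstrass_veechGen k (wordVector a) J
    rw [← h1] at h3
    rw [h2]
    exact SamePosition.trans h3 (ih _)

theorem wordPerm_derivedWord (a : TreeWord) : wordPerm (derivedWord a) = wordPerm a := by
  induction a using derivedWord.induct with
  | case1 => rfl
  | case2 k => rfl
  | case3 k w ih =>
    rw [derivedWord, if_pos rfl, ih]
    simp [wordPerm, ← mul_assoc, labelPerm_mul_self]
  | case4 k l w hkl ih =>
    rw [derivedWord, if_neg hkl]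
    simpa [wordPerm] using ih

/-- Holds for any number of derivations; that the process has stabilised plays no role. -/
theorem wordPerm_baseWord (a : TreeWord) : wordPerm (baseWord a) = wordPerm a := by
  have h (n : ℕ) (b : TreeWord) : wordPerm (derivedWord^[n] b) = wordPerm b := by
    induction n generalizing b with
    | zero => rfl
    | succ n ih => rw [Function.iterate_succ_apply, ih, wordPerm_derivedWord]
  exact h _ a

/-- Both sides have the position of the same Weierstrass point `τ_a J` in the horizontal direction.
-/
theorem goldenL_samePosition_baseWord (a : TreeWord) (J : Label) :
    SamePosition goldenL (goldenLDirection (baseWord a)) (goldenLMidpoint J) goldenL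
      (goldenLDirection a) (goldenLMidpoint J) := by
  have h := samePosition_wordPerm (baseWord a) J
  rw [wordPerm_baseWord] at h
  exact h.trans (samePosition_wordPerm a J).symm

/-! ### The regular pentagon in golden coordinates -/

/-- The height of the image of the unit square under the map to the double pentagon. -/
noncomputable def sinFifth : ℝ := Real.sin (Real.pi / 5)

theorem sinFifth_pos : 0 < sinFifth :=
  Real.sin_pos_of_pos_of_lt_pi (by positivity) (by linarith [Real.pi_pos])

theorem cos_pi_div_five_eq : Real.cos (Real.pi / 5) = φ / 2 := by
  rw [Real.cos_pi_div_five, Real.goldenRatio]; ring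

theorem sinFifth_mul_self : sinFifth * sinFifth = 1 - φ * φ / 4 := by
  have h := Real.sin_sq_add_cos_sq (Real.pi / 5)
  rw [cos_pi_div_five_eq] at h
  rw [sinFifth]
  linear_combination h

theorem exp_two_pi_div_five :
    Complex.exp (2 * Real.pi * Complex.I / 5) = ⟨(φ - 1) / 2, φ * sinFifth⟩ := by
  have e : 2 * (Real.pi : ℂ) * Complex.I / 5 = ((2 * (Real.pi / 5) : ℝ) : ℂ) * Complex.I := by
    push_cast; ring
  rw [e]
  apply Complex.ext
  · rw [Complex.exp_ofReal_mul_I_re, Real.cos_two_mul, cos_pi_div_five_eq]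
    linear_combination goldenRatio_mul_self / 2
  · rw [Complex.exp_ofReal_mul_I_im, Real.sin_two_mul, cos_pi_div_five_eq, sinFifth]
    ring

/-- The point with golden coordinates `(x, y)`, the image of the point `(x, y)` of the plane of the
golden L, in the first pentagon (`true`), or its negative in the second pentagon (`false`). -/
noncomputable def pentagonPoint (i : Bool) (x y : ℝ) : ℂ :=
  if i then ⟨x - φ + φ / 2 * y, sinFifth * y⟩ else ⟨-(x - φ + φ / 2 * y), -(sinFifth * y)⟩

theorem pentagonPoint_false (x y : ℝ) : pentagonPoint false x y = -pentagonPoint true x y := rfl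

theorem pentagonVertex_succ_eq {j : ℕ} {x y u w : ℝ} (h : pentagonVertex j = pentagonPoint true x y)
    (hj : Complex.exp (2 * Real.pi * Complex.I / 5) ^ j = ⟨u + φ / 2 * w, sinFifth * w⟩) :
    pentagonVertex (j + 1) = pentagonPoint true (x + u) (y + w) := by
  have e : pentagonVertex (j + 1) = pentagonVertex j + _ := Finset.sum_range_succ _ _
  rw [e, h, hj]
  apply Complex.ext <;> simp [pentagonPoint] <;> ring

/-- Rotation by `2π/5` in the basis formed by the columns of `P`: the vector `exp (2πi/5)` has
coordinates `(-1, φ)`, and the rotation is `(u, w) ↦ (-u - φ w, φ u + φ w)`. -/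
theorem exp_pow_succ {j : ℕ} {u w : ℝ}
    (h : Complex.exp (2 * Real.pi * Complex.I / 5) ^ j = ⟨u + φ / 2 * w, sinFifth * w⟩) :
    Complex.exp (2 * Real.pi * Complex.I / 5) ^ (j + 1) =
      ⟨-u - φ * w + φ / 2 * (φ * u + φ * w), sinFifth * (φ * u + φ * w)⟩ := by
  rw [pow_succ, h, exp_two_pi_div_five]
  apply Complex.ext
  · simp only [Complex.mul_re]
    linear_combination (-φ * w) * sinFifth_mul_self + (- u / 2 + w / 4 * φ) *
      goldenRatio_mul_self
  · simp only [Complex.mul_im]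
    linear_combination (sinFifth * w / 2) * goldenRatio_mul_self

theorem pentagonVertex_zero_eq : pentagonVertex 0 = pentagonPoint true φ 0 := by
  apply Complex.ext <;> simp [pentagonVertex, pentagonPoint]

theorem pentagonVertex_eq : pentagonVertex 1 = pentagonPoint true (φ + 1) 0 ∧
    pentagonVertex 2 = pentagonPoint true φ φ ∧ pentagonVertex 3 = pentagonPoint true 0 (φ + 1) ∧
    pentagonVertex 4 = pentagonPoint true 0 φ ∧ pentagonVertex 5 = pentagonPoint true φ 0 := by
  have hφ := goldenRatio_mul_self
  have e0 : Complex.exp (2 * Real.pi * Complex.I / 5) ^ 0 =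
      ⟨1 + φ / 2 * 0, sinFifth * 0⟩ := by
    rw [pow_zero]; apply Complex.ext <;> simp
  have e1 := exp_pow_succ e0
  have e2 := exp_pow_succ e1
  have e3 := exp_pow_succ e2
  have e4 := exp_pow_succ e3
  have h1 := pentagonVertex_succ_eq pentagonVertex_zero_eq e0
  have h2 := pentagonVertex_succ_eq h1 e1
  have h3 := pentagonVertex_succ_eq h2 e2
  have h4 := pentagonVertex_succ_eq h3 e3
  refine ⟨h1.trans ?_, h2.trans ?_, h3.trans ?_, h4.trans ?_, ?_⟩
  · congr 1; ring
  · congr 1 <;> grind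
  · congr 1 <;> grind
  · congr 1 <;> grind
  · rw [pentagonVertex_five, ← pentagonVertex_zero_eq]; simp [pentagonVertex]

/-- The golden coordinates of a vertex of the pentagon. -/
noncomputable def vertexCoord : ℕ → ℝ × ℝ
  | 0 => (φ, 0)
  | 1 => (φ + 1, 0)
  | 2 => (φ, φ)
  | 3 => (0, φ + 1)
  | 4 => (0, φ)
  | _ => (φ, 0)

theorem pentagonVertex_eq_pentagonPoint {j : ℕ} (hj : j ≤ 5) :
    pentagonVertex j = pentagonPoint true (vertexCoord j).1 (vertexCoord j).2 := by
  obtain ⟨h1, h2, h3, h4, h5⟩ := pentagonVertex_eq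
  interval_cases j
  exacts [pentagonVertex_zero_eq, h1, h2, h3, h4, h5]

/-- The inequalities that describe the pentagon in golden coordinates. -/
def InPentagon (x y : ℝ) : Prop :=
  0 ≤ x ∧ 0 ≤ y ∧ φ ≤ x + y ∧ φ * x + y ≤ 2 * φ + 1 ∧ x + φ * y ≤ 2 * φ + 1

/-- The linear part of the map from the golden L to the double pentagon. -/
noncomputable def toPentagon : ℂ →L[ℝ] ℂ := columnMap ⟨1, 0⟩ ⟨φ / 2, sinFifth⟩

/-- The inverse of the linear part of the map from the golden L to the double pentagon. -/
noncomputable def ofPentagon : ℂ →L[ℝ] ℂ := columnMap ⟨1, 0⟩ ⟨-φ / (2 * sinFifth), 1 / sinFifth⟩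

theorem ofPentagon_mk (x y : ℝ) : ofPentagon ⟨x + φ / 2 * y, sinFifth * y⟩ = ⟨x, y⟩ := by
  have := sinFifth_pos.ne'
  rw [ofPentagon, columnMap_apply]
  apply Complex.ext <;> field_simp <;> ring

theorem ofPentagon_pentagonPoint_true (x y : ℝ) :
    ofPentagon (pentagonPoint true x y) = ⟨x - φ, y⟩ :=
  ofPentagon_mk _ _

theorem ofPentagon_pentagonPoint_false (x y : ℝ) :
    ofPentagon (pentagonPoint false x y) = ⟨φ - x, -y⟩ := by
  rw [pentagonPoint_false, map_neg, ofPentagon_pentagonPoint_true]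
  apply Complex.ext <;> simp

theorem exists_pentagonPoint_eq (i : Bool) (z : ℂ) : ∃ x y : ℝ, z = pentagonPoint i x y := by
  have := sinFifth_pos.ne'
  have H (z : ℂ) : ∃ x y : ℝ, z = pentagonPoint true x y := by
    refine ⟨z.re + φ - φ / 2 * (z.im / sinFifth), z.im / sinFifth, Complex.ext ?_ ?_⟩
    · simp [pentagonPoint]; ring
    · simp [pentagonPoint]; field_simp
  cases i
  · obtain ⟨x, y, h⟩ := H (-z)
    exact ⟨x, y, by rw [pentagonPoint_false, ← h, neg_neg]⟩
  · exact H z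

theorem Convex.mem_of_triple {s : Set ℂ} (hs : Convex ℝ s) {u v w : ℂ} (hu : u ∈ s) (hv : v ∈ s)
    (hw : w ∈ s) {a b c : ℝ} (ha : 0 ≤ a) (hb : 0 ≤ b) (hc : 0 ≤ c) (h : a + b + c = 1) :
    a • u + b • v + c • w ∈ s := by
  have := hs.sum_mem (t := Finset.univ) (w := ![a, b, c]) (z := ![u, v, w])
    (by intro i _; fin_cases i <;> assumption)
    (by simpa [Fin.sum_univ_three] using h) (by intro i _; fin_cases i <;> assumption)
  simpa [Fin.sum_univ_three] using this

/-- Passes between the convex hull of five vertices and the five half-planes of the sides. One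
direction needs only the vertices; the other uses a triangulation. -/
theorem pentagonPoint_mem_pentagonRegion {x y : ℝ} :
    pentagonPoint true x y ∈ pentagonRegion ↔ InPentagon x y := by
  have h0 := Real.one_lt_goldenRatio
  have hφ := goldenRatio_mul_self
  have hv : ∀ j : ℕ, (hj : j < 5) →
      pentagonPoint true (vertexCoord j).1 (vertexCoord j).2 ∈ pentagonRegion := by
    intro j hj
    rw [← pentagonVertex_eq_pentagonPoint hj.le]
    exact pentagonVertex_mem j hj.le
  constructor
  · intro h
    -- These are the inequalities of `InPentagon` written in `x - φ`, because `ofPentagon` does not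
    -- undo the translation by `φ`.
    have hc : Convex ℝ (ofPentagon ⁻¹' (halfPlane (-1) 0 φ ∩ halfPlane 0 (-1) 0 ∩
        halfPlane (-1) (-1) 0 ∩ halfPlane φ 1 φ ∩ halfPlane 1 φ (φ + 1))) :=
      (((((convex_halfPlane _ _ _).inter (convex_halfPlane _ _ _)).inter
        (convex_halfPlane _ _ _)).inter (convex_halfPlane _ _ _)).inter
        (convex_halfPlane _ _ _)).linear_preimage ofPentagon.toLinearMap
    have := convexHull_min (s := Set.range fun j : Fin 5 => pentagonVertex j) ?_ hc h
    · rw [Set.mem_preimage, ofPentagon_pentagonPoint_true] at this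
      simp only [Set.mem_inter_iff, mem_halfPlane] at this
      unfold InPentagon
      grind
    · rintro _ ⟨j, rfl⟩
      dsimp only
      rw [Set.mem_preimage, pentagonVertex_eq_pentagonPoint j.2.le, ofPentagon_pentagonPoint_true]
      simp only [Set.mem_inter_iff, mem_halfPlane]
      fin_cases j <;> simp only [vertexCoord] <;> grind
  · rintro ⟨h1, h2, h3, h4, h5⟩
    have hconv : Convex ℝ pentagonRegion := convex_convexHull ℝ _
    have h6 : 0 ≤ (φ - 1) * y := mul_nonneg (by linarith) h2
    have h7 : 0 ≤ (φ - 1) * x := mul_nonneg (by linarith) h1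
    -- The diagonals `x = φ` and `y = φ` from the vertex `(φ, φ)` cut the pentagon into three
    -- triangles. The barycentric coordinates involve division by `φ`, that is, multiplication by `φ
    -- - 1`.
    rcases le_total φ x with hx | hx
    · have h8 : 0 ≤ (φ - 1) * (2 * φ + 1 - (φ * x + y)) := mul_nonneg (by linarith) (by linarith)
      have := hconv.mem_of_triple (hv 0 (by norm_num)) (hv 1 (by norm_num)) (hv 2 (by norm_num))
        (a := 1 - (x - φ) - (φ - 1) * y) (b := x - φ) (c := (φ - 1) * y)
        (by linear_combination h8 + (2 - x) * hφ) (by linarith) h6 (by ring)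
      convert this using 1
      apply Complex.ext <;> simp [pentagonPoint, vertexCoord] <;> grind
    rcases le_total φ y with hy | hy
    · have h8 : 0 ≤ (φ - 1) * (2 * φ + 1 - (x + φ * y)) := mul_nonneg (by linarith) (by linarith)
      have := hconv.mem_of_triple (hv 4 (by norm_num)) (hv 3 (by norm_num)) (hv 2 (by norm_num))
        (a := 1 - (y - φ) - (φ - 1) * x) (b := y - φ) (c := (φ - 1) * x)
        (by linear_combination h8 + (2 - y) * hφ) (by linarith) h7 (by ring)
      convert this using 1
      apply Complex.ext <;> simp [pentagonPoint, vertexCoord] <;> grind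
    · have h8 : 0 ≤ (φ - 1) * (x + y - φ) := mul_nonneg (by linarith) (by linarith)
      have h9 : 0 ≤ (φ - 1) * (φ - x) := mul_nonneg (by linarith) (by linarith)
      have h10 : 0 ≤ (φ - 1) * (φ - y) := mul_nonneg (by linarith) (by linarith)
      have := hconv.mem_of_triple (hv 0 (by norm_num)) (hv 4 (by norm_num)) (hv 2 (by norm_num))
        (a := 1 - (φ - 1) * y) (b := 1 - (φ - 1) * x) (c := (φ - 1) * (x + y) - 1)
        (by grind) (by grind) (by grind) (by ring)
      convert this using 1
      apply Complex.ext <;> simp [pentagonPoint, vertexCoord] <;> grind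

/-! ### The double pentagon in golden coordinates -/

theorem pentagonPoint_mem_region {i : Bool} {x y : ℝ} :
    pentagonPoint i x y ∈ doublePentagon.region i ↔ InPentagon x y := by
  rw [← pentagonPoint_mem_pentagonRegion]
  cases i
  · simp [doublePentagon, pentagonPoint_false]
  · simp [doublePentagon]

/-- Equality of points of the double pentagon in golden coordinates. -/
def SamePentagon (i : Bool) (x y : ℝ) (j : Bool) (u w : ℝ) : Prop :=
  doublePentagon.Same i (pentagonPoint i x y) j (pentagonPoint j u w)

theorem SamePentagon.coord_congr {i j : Bool} {x y u w x' y' u' w' : ℝ}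
    (h : SamePentagon i x y j u w) (hx : x' = x) (hy : y' = y) (hu : u' = u) (hw : w' = w) :
    SamePentagon i x' y' j u' w' := by
  subst hx hy hu hw; exact h

theorem SamePentagon.refl {i : Bool} {x y : ℝ} (h : InPentagon x y) : SamePentagon i x y i x y :=
  Same.refl (pentagonPoint_mem_region.2 h)

/-- The point that divides the side `j` of the first pentagon in the ratio `t`. -/
noncomputable def sidePoint (i : Bool) (j : Fin 5) (t : ℝ) : ℂ :=
  pentagonPoint i ((1 - t) * (vertexCoord j).1 + t * (vertexCoord (j + 1)).1)
    ((1 - t) * (vertexCoord j).2 + t * (vertexCoord (j + 1)).2)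

theorem sidePoint_true_eq (j : Fin 5) (t : ℝ) :
    sidePoint true j t = (1 - t) • pentagonVertex j + t • pentagonVertex (j + 1) := by
  rw [pentagonVertex_eq_pentagonPoint j.2.le,
    pentagonVertex_eq_pentagonPoint (Nat.succ_le_of_lt j.2)]
  apply Complex.ext <;> simp [sidePoint, pentagonPoint] <;> ring

theorem mem_side_iff {j : Fin 5} {z : ℂ} :
    z ∈ segment ℝ (pentagonVertex j) (pentagonVertex (j + 1)) ↔
      ∃ t : ℝ, 0 ≤ t ∧ t ≤ 1 ∧ z = sidePoint true j t := by
  constructor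
  · rintro ⟨s, t, hs, ht, hst, rfl⟩
    obtain rfl : s = 1 - t := by linarith
    exact ⟨t, ht, by linarith, (sidePoint_true_eq j t).symm⟩
  · rintro ⟨t, h, h', rfl⟩
    exact ⟨1 - t, t, by linarith, h, by ring, (sidePoint_true_eq j t).symm⟩

/-- The paired side of the second pentagon is the negative of the side, so a translation reverses
its parametrisation. -/
theorem sidePoint_add_shift (j : Fin 5) (t : ℝ) :
    sidePoint true j t + doublePentagon.shift j = sidePoint false j (1 - t) := by
  have h : sidePoint false j (1 - t) = -sidePoint true j (1 - t) := rfl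
  change _ + -(pentagonVertex j + pentagonVertex (j + 1)) = _
  rw [h, sidePoint_true_eq, sidePoint_true_eq]
  simp only [Complex.real_smul]
  push_cast
  ring

theorem sidePoint_mem_region (i : Bool) (j : Fin 5) {t : ℝ} (h : 0 ≤ t) (h' : t ≤ 1) :
    sidePoint i j t ∈ doublePentagon.region i := by
  have : sidePoint true j t ∈ pentagonRegion :=
    (convex_convexHull ℝ _).segment_subset (pentagonVertex_mem _ j.2.le)
      (pentagonVertex_mem _ j.2) (mem_side_iff.2 ⟨t, h, h', rfl⟩)
  exact pentagonPoint_mem_region.2 (pentagonPoint_mem_pentagonRegion.1 this)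

theorem samePentagon_side (j : Fin 5) {t : ℝ} (h : 0 ≤ t) (h' : t ≤ 1) :
    SamePentagon true
      ((1 - t) * (vertexCoord j).1 + t * (vertexCoord (j + 1)).1)
      ((1 - t) * (vertexCoord j).2 + t * (vertexCoord (j + 1)).2) false
      ((1 - (1 - t)) * (vertexCoord j).1 + (1 - t) * (vertexCoord (j + 1)).1)
      ((1 - (1 - t)) * (vertexCoord j).2 + (1 - t) * (vertexCoord (j + 1)).2) := by
  have e := sidePoint_add_shift j t
  have h1 := sidePoint_mem_region false j (t := 1 - t) (by linarith) (by linarith)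
  have := Same.glue (S := doublePentagon) j (mem_side_iff.2 ⟨t, h, h', rfl⟩)
    (sidePoint_mem_region true j h h') (e ▸ h1)
  rwa [e] at this

theorem samePentagon_side_zero {x : ℝ} (h : φ ≤ x) (h' : x ≤ φ + 1) :
    SamePentagon true x 0 false (2 * φ + 1 - x) 0 := by
  refine (samePentagon_side 0 (t := x - φ) (by linarith) (by linarith)).coord_congr ?_ ?_ ?_ ?_ <;>
    simp [vertexCoord] <;> ring

theorem samePentagon_side_one {x y : ℝ} (h : φ ≤ x) (h' : x ≤ φ + 1)
    (hxy : φ * x + y = 2 * φ + 1) : SamePentagon true x y false (2 * φ + 1 - x) (φ - y) := by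
  refine (samePentagon_side 1 (t := φ + 1 - x) (by linarith) (by linarith)).coord_congr
    ?_ ?_ ?_ ?_ <;> simp [vertexCoord] <;> grind [goldenRatio_mul_self]

theorem samePentagon_side_two {x y : ℝ} (h : φ ≤ y) (h' : y ≤ φ + 1)
    (hxy : x + φ * y = 2 * φ + 1) : SamePentagon true x y false (φ - x) (2 * φ + 1 - y) := by
  refine (samePentagon_side 2 (t := y - φ) (by linarith) (by linarith)).coord_congr
    ?_ ?_ ?_ ?_ <;> simp [vertexCoord] <;> grind [goldenRatio_mul_self]

theorem samePentagon_side_three {y : ℝ} (h : φ ≤ y) (h' : y ≤ φ + 1) :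
    SamePentagon true 0 y false 0 (2 * φ + 1 - y) := by
  refine (samePentagon_side 3 (t := φ + 1 - y) (by linarith) (by linarith)).coord_congr
    ?_ ?_ ?_ ?_ <;> simp [vertexCoord] <;> ring

theorem samePentagon_side_four {x y : ℝ} (h : 0 ≤ x) (h' : x ≤ φ)
    (hxy : x + y = φ) : SamePentagon true x y false (φ - x) (φ - y) := by
  have h0 := Real.one_lt_goldenRatio
  have hφ := goldenRatio_mul_self
  have h1 : 0 ≤ (φ - 1) * x := mul_nonneg (by linarith) h
  have h2 : 0 ≤ (φ - 1) * (φ - x) := mul_nonneg (by linarith) (by linarith)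
  -- This side runs from `(0, φ)` to `(φ, 0)`, so the parameter is `x / φ = (φ - 1) x`.
  refine (samePentagon_side 4 (t := (φ - 1) * x) (by linarith) (by linarith)).coord_congr
    ?_ ?_ ?_ ?_ <;> simp [vertexCoord] <;> grind

/-! ### Cutting the golden L and pasting the double pentagon -/

theorem toPentagon_add_true (x y : ℝ) :
    toPentagon ⟨x, y⟩ + ⟨-φ, 0⟩ = pentagonPoint true x y := by
  rw [toPentagon, columnMap_add]
  apply Complex.ext <;> simp [pentagonPoint]
  ring

theorem toPentagon_add_lower (x y : ℝ) : toPentagon ⟨x, y⟩ + ⟨-φ / 2 * φ, -φ * sinFifth⟩ =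
    pentagonPoint false (φ - x) (φ - y) := by
  rw [toPentagon, columnMap_add]
  apply Complex.ext <;> simp [pentagonPoint] <;> ring

theorem toPentagon_add_right (x y : ℝ) :
    toPentagon ⟨x, y⟩ + ⟨-φ - 1 - φ / 2 * φ, -φ * sinFifth⟩ =
      pentagonPoint false (2 * φ + 1 - x) (φ - y) := by
  rw [toPentagon, columnMap_add]
  apply Complex.ext <;> simp [pentagonPoint] <;> ring

theorem toPentagon_add_upper (x y : ℝ) :
    toPentagon ⟨x, y⟩ + ⟨-φ / 2 * (2 * φ + 1), -(2 * φ + 1) * sinFifth⟩ =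
      pentagonPoint false (φ - x) (2 * φ + 1 - y) := by
  rw [toPentagon, columnMap_add]
  apply Complex.ext <;> simp [pentagonPoint] <;> ring

/-- Division by `φ`, using `1/φ = φ - 1`. It trades `φ * x` for `φ * y`, so that bounds on the two
products can be combined linearly. -/
theorem goldenRatio_slope (x y : ℝ) :
    (φ * x + y ≤ 2 * φ + 1 ↔ x + φ * y - y ≤ φ + 1) ∧
    (2 * φ + 1 ≤ φ * x + y ↔ φ + 1 ≤ x + φ * y - y) := by
  have h0 := Real.goldenRatio_pos
  have e : φ * x + y - (2 * φ + 1) = φ * (x + φ * y - y - (φ + 1)) := by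
    linear_combination (1 - y) * goldenRatio_mul_self
  constructor
  · rw [← sub_nonpos, e, mul_nonpos_iff_pos_imp_nonpos, ← sub_nonpos (b := φ + 1)]
    grind
  · rw [← sub_nonneg, e, mul_nonneg_iff_of_pos_left h0, sub_nonneg]

theorem pentagonPoint_mem_vertices (i : Bool) {x y : ℝ} (h : x = φ ∧ y = 0 ∨ x = φ + 1 ∧ y = 0 ∨
    x = φ ∧ y = φ ∨ x = 0 ∧ y = φ + 1 ∨ x = 0 ∧ y = φ) :
    pentagonPoint i x y ∈ doublePentagon.vertices i := by
  have key : ∃ j : Fin 5, pentagonVertex j = pentagonPoint true x y := by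
    obtain ⟨h1, h2, h3, h4, -⟩ := pentagonVertex_eq
    rcases h with ⟨rfl, rfl⟩ | ⟨rfl, rfl⟩ | ⟨rfl, rfl⟩ | ⟨rfl, rfl⟩ | ⟨rfl, rfl⟩
    exacts [⟨0, pentagonVertex_zero_eq⟩, ⟨1, h1⟩, ⟨2, h2⟩, ⟨3, h3⟩, ⟨4, h4⟩]
  obtain ⟨j, hj⟩ := key
  cases i
  · exact ⟨j, by rw [pentagonPoint_false, ← hj]⟩
  · exact ⟨j, hj⟩

/-- The golden L is cut into the inscribed pentagon and three triangles, which are pasted to the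
second pentagon. -/
noncomputable def pentagonCutPaste : CutPaste goldenL doublePentagon toPentagon :=
  goldenLCutPaste doublePentagon _ 4 ![true, false, false, false]
    -- The inscribed pentagon, then the lower left, right and upper triangles outside it. The sides
    -- `x = 0` and `y = 0` of the pentagon are implied by the L itself.
    ![halfPlane (-1) (-1) (-φ) ∩ halfPlane φ 1 (2 * φ + 1) ∩ halfPlane 1 φ (2 * φ + 1),
      halfPlane 1 1 φ,
      halfPlane 0 1 φ ∩ halfPlane (-φ) (-1) (-(2 * φ + 1)),
      halfPlane 1 0 φ ∩ halfPlane (-1) (-φ) (-(2 * φ + 1))]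
    ![⟨-φ, 0⟩, ⟨-φ / 2 * φ, -φ * sinFifth⟩, ⟨-φ - 1 - φ / 2 * φ, -φ * sinFifth⟩,
      ⟨-φ / 2 * (2 * φ + 1), -(2 * φ + 1) * sinFifth⟩]
    (by
      intro k
      fin_cases k
      · exact ((isClosed_halfPlane _ _ _).inter (isClosed_halfPlane _ _ _)).inter
          (isClosed_halfPlane _ _ _)
      · exact isClosed_halfPlane _ _ _
      · exact (isClosed_halfPlane _ _ _).inter (isClosed_halfPlane _ _ _)
      · exact (isClosed_halfPlane _ _ _).inter (isClosed_halfPlane _ _ _))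
    (by
      intro k
      fin_cases k
      · exact ((convex_halfPlane _ _ _).inter (convex_halfPlane _ _ _)).inter
          (convex_halfPlane _ _ _)
      · exact convex_halfPlane _ _ _
      · exact (convex_halfPlane _ _ _).inter (convex_halfPlane _ _ _)
      · exact (convex_halfPlane _ _ _).inter (convex_halfPlane _ _ _))
    (by
      intro x y h
      have h0 := Real.one_lt_goldenRatio
      have hφ := goldenRatio_mul_self
      have h2 : y ≤ φ → φ * y ≤ φ * φ := fun h => mul_le_mul_of_nonneg_left h (by linarith)
      have h3 : x ≤ φ → φ * x ≤ φ * φ := fun h => mul_le_mul_of_nonneg_left h (by linarith)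
      rw [mem_goldenLRegion] at h
      have h4 := goldenRatio_slope x y
      have h5 := goldenRatio_slope y x
      rcases le_total (x + y) φ with h1 | h1
      · exact ⟨1, by simp [mem_halfPlane]; grind⟩
      rcases le_or_gt y φ with h6 | h6
      · rcases le_or_gt (φ * x + y) (2 * φ + 1) with h7 | h7
        · exact ⟨0, by simp [mem_halfPlane]; grind⟩
        · exact ⟨2, by simp [mem_halfPlane]; grind⟩
      · rcases le_or_gt (x + φ * y) (2 * φ + 1) with h7 | h7
        · exact ⟨0, by simp [mem_halfPlane]; grind⟩
        · exact ⟨3, by simp [mem_halfPlane]; grind⟩)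
    (by
      intro k l hkl x y hz hk hl
      have h0 := Real.one_lt_goldenRatio
      have hφ := goldenRatio_mul_self
      have h2 : y ≤ φ → φ * y ≤ φ * φ := fun h => mul_le_mul_of_nonneg_left h (by linarith)
      have h3 : x ≤ φ → φ * x ≤ φ * φ := fun h => mul_le_mul_of_nonneg_left h (by linarith)
      have h4 := goldenRatio_slope x y
      have h5 := goldenRatio_slope y x
      have h6 : 0 ≤ x → φ * x ≤ 2 * x := fun h =>
        mul_le_mul_of_nonneg_right Real.goldenRatio_lt_two.le h
      have h7 : 0 ≤ y → φ * y ≤ 2 * y := fun h =>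
        mul_le_mul_of_nonneg_right Real.goldenRatio_lt_two.le h
      have h8 : 0 ≤ x → φ * 0 ≤ φ * x := fun h => mul_le_mul_of_nonneg_left h (by linarith)
      have h9 : 0 ≤ y → φ * 0 ≤ φ * y := fun h => mul_le_mul_of_nonneg_left h (by linarith)
      rw [mem_goldenLRegion] at hz
      fin_cases k <;> fin_cases l <;>
        simp only [Fin.zero_eta, Fin.mk_one, Fin.reduceFinMk, Fin.isValue, Fin.reduceLE,
          Matrix.cons_val, Set.mem_inter_iff, mem_halfPlane, toPentagon_add_true,
          toPentagon_add_lower, toPentagon_add_right, toPentagon_add_upper] at hkl hk hl ⊢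
      · exact SamePentagon.refl (by unfold InPentagon; grind)
      · exact samePentagon_side_four (by grind) (by grind) (by grind)
      · exact samePentagon_side_one (by grind) (by grind) (by grind)
      · exact samePentagon_side_two (by grind) (by grind) (by grind)
      · exact SamePentagon.refl (by unfold InPentagon; grind)
      -- The lower left triangle meets neither of the other two: on it `φ x + y` and `x + φ y` are
      -- at most `φ² = φ + 1 < 2 φ + 1`.
      · grind
      · grind
      · exact SamePentagon.refl (by unfold InPentagon; grind)
      -- The right and upper triangles meet only at `(φ, φ)`. Its images `(φ + 1, 0)` and `(0, φ +
      -- 1)` in the second pentagon are both glued to the vertex `(φ, φ)` of the first.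
      · exact SamePentagon.coord_congr (Same.trans (samePentagon_side_one (x := φ) (y := φ)
          (by linarith) (by linarith) (by linarith)).symm
          (samePentagon_side_two (by linarith) (by linarith) (by linarith)))
          (by grind) (by grind) (by grind) (by grind)
      · exact SamePentagon.refl (by unfold InPentagon; grind))
    (by
      intro y h h'
      have h0 := Real.one_lt_goldenRatio
      have hφ := goldenRatio_mul_self
      have h3 : φ * y ≤ φ * (φ + 1) := mul_le_mul_of_nonneg_left h' (by linarith)
      have h4 : φ * φ ≤ φ * y := mul_le_mul_of_nonneg_left h (by linarith)
      refine ⟨0, 3, ?_⟩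
      simp only [mem_halfPlane, Matrix.cons_val, Set.mem_inter_iff, toPentagon_add_true,
        toPentagon_add_upper]
      exact ⟨by grind, by grind, (samePentagon_side_three h h').coord_congr
        (by ring) (by ring) (by ring) (by ring)⟩)
    (by
      intro y h h'
      have h0 := Real.one_lt_goldenRatio
      have hφ := goldenRatio_mul_self
      have h3 : φ * 0 ≤ φ * y := mul_le_mul_of_nonneg_left h (by linarith)
      have h4 : φ * y ≤ φ * φ := mul_le_mul_of_nonneg_left h' (by linarith)
      refine ⟨1, 2, ?_⟩
      simp only [mem_halfPlane, Matrix.cons_val, Set.mem_inter_iff, toPentagon_add_lower,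
        toPentagon_add_right]
      exact ⟨by grind, by grind, (SamePentagon.refl (i := false) (x := φ) (y := φ - y)
        (by unfold InPentagon; grind)).coord_congr (by ring) (by ring) (by ring) (by ring)⟩)
    (by
      intro x h h'
      have h0 := Real.one_lt_goldenRatio
      have hφ := goldenRatio_mul_self
      have h3 : φ * 0 ≤ φ * x := mul_le_mul_of_nonneg_left h (by linarith)
      have h4 : φ * x ≤ φ * φ := mul_le_mul_of_nonneg_left h' (by linarith)
      refine ⟨1, 3, ?_⟩
      simp only [mem_halfPlane, Matrix.cons_val, Set.mem_inter_iff, toPentagon_add_lower,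
        toPentagon_add_upper]
      exact ⟨by grind, by grind, (SamePentagon.refl (i := false) (x := φ - x) (y := φ)
        (by unfold InPentagon; grind)).coord_congr (by ring) (by ring) (by ring) (by ring)⟩)
    (by
      intro x h h'
      have h0 := Real.one_lt_goldenRatio
      have hφ := goldenRatio_mul_self
      have h3 : φ * x ≤ φ * (φ + 1) := mul_le_mul_of_nonneg_left h' (by linarith)
      have h4 : φ * φ ≤ φ * x := mul_le_mul_of_nonneg_left h (by linarith)
      refine ⟨0, 2, ?_⟩
      simp only [mem_halfPlane, Matrix.cons_val, Set.mem_inter_iff, toPentagon_add_true,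
        toPentagon_add_right]
      exact ⟨by grind, by grind, (samePentagon_side_zero h h').coord_congr
        (by ring) (by ring) (by ring) (by ring)⟩)
    (by
      have h0 := Real.one_lt_goldenRatio
      have hφ := goldenRatio_mul_self
      rw [goldenL_forall_vertices]
      refine ⟨⟨1, ?_⟩, ⟨0, ?_⟩, ⟨0, ?_⟩, ⟨2, ?_⟩, ⟨0, ?_⟩, ⟨3, ?_⟩, ⟨0, ?_⟩, ⟨0, ?_⟩⟩ <;>
        simp only [Matrix.cons_val, Set.mem_inter_iff, mem_halfPlane, toPentagon_add_true,
          toPentagon_add_lower, toPentagon_add_right, toPentagon_add_upper] <;>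
        refine ⟨by grind, pentagonPoint_mem_vertices _ (by grind)⟩)

/-- This and the next three lemmas translate the cuts `x = φ` and `y = φ` of the second pentagon
into half-planes in Cartesian coordinates. -/
theorem mem_halfPlane_left {x y : ℝ} :
    pentagonPoint false x y ∈ halfPlane (-1) (φ / (2 * sinFifth)) 0 ↔ x ≤ φ := by
  have := sinFifth_pos.ne'
  have e : -1 * (pentagonPoint false x y).re + φ / (2 * sinFifth) * (pentagonPoint false x y).im =
      x - φ := by
    simp only [pentagonPoint, Bool.false_eq_true, if_false]; field_simp; ring
  rw [halfPlane, Set.mem_ofPred_eq, e, sub_nonpos]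

theorem mem_halfPlane_right {x y : ℝ} :
    pentagonPoint false x y ∈ halfPlane 1 (-φ / (2 * sinFifth)) 0 ↔ φ ≤ x := by
  have := sinFifth_pos.ne'
  have e : 1 * (pentagonPoint false x y).re + -φ / (2 * sinFifth) * (pentagonPoint false x y).im =
      φ - x := by
    simp only [pentagonPoint, Bool.false_eq_true, if_false]; field_simp; ring
  rw [halfPlane, Set.mem_ofPred_eq, e, sub_nonpos]

theorem mem_halfPlane_lower {x y : ℝ} :
    pentagonPoint false x y ∈ halfPlane 0 (-1 / sinFifth) φ ↔ y ≤ φ := by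
  have := sinFifth_pos.ne'
  have e : 0 * (pentagonPoint false x y).re + -1 / sinFifth * (pentagonPoint false x y).im =
      y := by
    simp only [pentagonPoint, Bool.false_eq_true, if_false]; field_simp; ring
  rw [halfPlane, Set.mem_ofPred_eq, e]

theorem mem_halfPlane_upper {x y : ℝ} :
    pentagonPoint false x y ∈ halfPlane 0 (1 / sinFifth) (-φ) ↔ φ ≤ y := by
  have := sinFifth_pos.ne'
  have e : 0 * (pentagonPoint false x y).re + 1 / sinFifth * (pentagonPoint false x y).im =
      -y := by
    simp only [pentagonPoint, Bool.false_eq_true, if_false]; field_simp; ring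
  rw [halfPlane, Set.mem_ofPred_eq, e, neg_le_neg_iff]

/-- The second pentagon is cut into three triangles, which are pasted to the first pentagon to give
the golden L. -/
noncomputable def pentagonCutPasteInv : CutPaste doublePentagon goldenL ofPentagon where
  κ := Fin 4
  finite := inferInstance
  src := ![true, false, false, false]
  tgt _ := ()
  piece := ![Set.univ,
    halfPlane (-1) (φ / (2 * sinFifth)) 0 ∩ halfPlane 0 (-1 / sinFifth) φ,
    halfPlane 1 (-φ / (2 * sinFifth)) 0,
    halfPlane 0 (1 / sinFifth) (-φ)]
  trans := ![⟨φ, 0⟩, ⟨0, φ⟩, ⟨φ + 1, φ⟩, ⟨0, 2 * φ + 1⟩]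
  isClosed_piece k := by
    fin_cases k
    exacts [isClosed_univ, (isClosed_halfPlane _ _ _).inter (isClosed_halfPlane _ _ _),
      isClosed_halfPlane _ _ _, isClosed_halfPlane _ _ _]
  convex_piece k := by
    fin_cases k
    exacts [convex_univ, (convex_halfPlane _ _ _).inter (convex_halfPlane _ _ _),
      convex_halfPlane _ _ _, convex_halfPlane _ _ _]
  cover := by
    rintro i z -
    obtain ⟨x, y, rfl⟩ := exists_pentagonPoint_eq i z
    cases i
    · rcases le_total x φ with h | h
      · rcases le_total y φ with h' | h'
        · exact ⟨1, rfl, mem_halfPlane_left.2 h, mem_halfPlane_lower.2 h'⟩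
        · exact ⟨3, rfl, mem_halfPlane_upper.2 h'⟩
      · exact ⟨2, rfl, mem_halfPlane_right.2 h⟩
    · exact ⟨0, rfl, trivial⟩
  compat := by
    have h0 := Real.one_lt_goldenRatio
    have hφ := goldenRatio_mul_self
    intro k l z hkl hz hk hl
    obtain ⟨x, y, rfl⟩ := exists_pentagonPoint_eq (![true, false, false, false] k) z
    replace hz := pentagonPoint_mem_region.1 hz
    have h2 : y ≤ φ → φ * y ≤ φ * φ := fun h => mul_le_mul_of_nonneg_left h (by linarith)
    have h3 : x ≤ φ → φ * x ≤ φ * φ := fun h => mul_le_mul_of_nonneg_left h (by linarith)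
    have h6 : φ ≤ x → φ * φ ≤ φ * x := fun h => mul_le_mul_of_nonneg_left h (by linarith)
    have h7 : φ ≤ y → φ * φ ≤ φ * y := fun h => mul_le_mul_of_nonneg_left h (by linarith)
    obtain ⟨h8, h9, h10, h11, h12⟩ := hz
    have h13 : φ * 0 ≤ φ * x := mul_le_mul_of_nonneg_left h8 (by linarith)
    have h14 : φ * 0 ≤ φ * y := mul_le_mul_of_nonneg_left h9 (by linarith)
    have h4 := goldenRatio_slope x y
    have h5 := goldenRatio_slope y x
    have h15 : φ * x ≤ 2 * x := mul_le_mul_of_nonneg_right Real.goldenRatio_lt_two.le h8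
    have h16 : φ * y ≤ 2 * y := mul_le_mul_of_nonneg_right Real.goldenRatio_lt_two.le h9
    have h17 : y ≤ φ * y := le_mul_of_one_le_left h9 h0.le
    have h18 : x ≤ φ * x := le_mul_of_one_le_left h8 h0.le
    have hx : x ≤ φ + 1 := by grind
    have hy : y ≤ φ + 1 := by grind
    fin_cases k <;> fin_cases l <;>
      simp only [Fin.zero_eta, Fin.mk_one, Fin.reduceFinMk, Fin.isValue,
        Matrix.cons_val, Set.mem_inter_iff, mem_halfPlane_left, mem_halfPlane_right,
        mem_halfPlane_lower, mem_halfPlane_upper, ofPentagon_pentagonPoint_true,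
        ofPentagon_pentagonPoint_false, Complex.mk_add_mk, reduceCtorEq] at hkl hk hl ⊢
    · exact .refl (mem_goldenLRegion.2 (by grind))
    · exact .refl (mem_goldenLRegion.2 (by grind))
    · exact (goldenL_same_lower_sides (y := φ - y) (by grind) (by grind)).coord_congr
          (by grind) (by grind) (by grind) (by grind)
    · exact (goldenL_same_left_sides (x := φ - x) (by grind) (by grind)).coord_congr
          (by grind) (by grind) (by grind) (by grind)
    · exact (goldenL_same_lower_sides (y := φ - y) (by grind) (by grind)).symm.coord_congr
          (by grind) (by grind) (by grind) (by grind)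
    · exact .refl (mem_goldenLRegion.2 (by grind))
    -- The two outer triangles meet only at the vertex `(φ, φ)`; its images `(φ + 1, 0)` and `(0, φ
    -- + 1)` are identified through the origin.
    · exact ((goldenL_same_lower_sides (y := 0) (by grind) (by grind)).symm.trans
        (goldenL_same_left_sides (x := 0) (by grind) (by grind))).coord_congr
          (by grind) (by grind) (by grind) (by grind)
    · exact (goldenL_same_left_sides (x := φ - x) (by grind) (by grind)).symm.coord_congr
          (by grind) (by grind) (by grind) (by grind)
    · exact ((goldenL_same_lower_sides (y := 0) (by grind) (by grind)).symm.trans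
        (goldenL_same_left_sides (x := 0) (by grind) (by grind))).symm.coord_congr
          (by grind) (by grind) (by grind) (by grind)
    · exact .refl (mem_goldenLRegion.2 (by grind))
  glue := by
    have h0 := Real.one_lt_goldenRatio
    have hφ := goldenRatio_mul_self
    intro j z hs _ _
    change Fin 5 at j
    obtain ⟨t, ht, ht', rfl⟩ := mem_side_iff.1 hs
    rw [sidePoint_add_shift]
    have h1 : φ * 0 ≤ φ * t := mul_le_mul_of_nonneg_left ht (by linarith)
    have h2 : φ * t ≤ φ * 1 := mul_le_mul_of_nonneg_left ht' (by linarith)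
    -- Each side of the second pentagon belongs to one triangle. Sides 1, 2 and 4 become interior
    -- cuts of the L, where both images coincide; sides 0 and 3 become glued boundary sides of the
    -- L.
    fin_cases j <;> [refine ⟨0, 2, rfl, rfl, trivial, mem_halfPlane_right.2 ?_, ?_⟩;
      refine ⟨0, 2, rfl, rfl, trivial, mem_halfPlane_right.2 ?_, ?_⟩;
      refine ⟨0, 3, rfl, rfl, trivial, mem_halfPlane_upper.2 ?_, ?_⟩;
      refine ⟨0, 3, rfl, rfl, trivial, mem_halfPlane_upper.2 ?_, ?_⟩;
      refine ⟨0, 1, rfl, rfl, trivial, ⟨mem_halfPlane_left.2 ?_, mem_halfPlane_lower.2 ?_⟩, ?_⟩] <;>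
      simp only [sidePoint, ofPentagon_pentagonPoint_true, ofPentagon_pentagonPoint_false,
        Complex.mk_add_mk, Matrix.cons_val, Fin.isValue, vertexCoord, Nat.reduceAdd]
    · grind
    · exact (goldenL_same_right_sides (x := φ + t) (by grind) (by grind)).coord_congr
        (by grind) (by grind) (by grind) (by grind)
    · grind
    · exact (Same.refl (S := goldenL) (i := ()) (z := ⟨φ + 1 - t, φ * t⟩)
        (mem_goldenLRegion.2 (by grind))).coord_congr
        (by grind) (by grind) (by grind) (by grind)
    · grind
    · exact (Same.refl (S := goldenL) (i := ()) (z := ⟨φ - φ * t, φ + t⟩)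
        (mem_goldenLRegion.2 (by grind))).coord_congr
        (by grind) (by grind) (by grind) (by grind)
    · grind
    · exact (goldenL_same_upper_sides (y := φ + 1 - t) (by grind) (by grind)).coord_congr
        (by grind) (by grind) (by grind) (by grind)
    · grind
    · grind
    · exact (Same.refl (S := goldenL) (i := ()) (z := ⟨φ * t, φ - φ * t⟩)
        (mem_goldenLRegion.2 (by grind))).coord_congr
        (by grind) (by grind) (by grind) (by grind)
  vertex := by
    have h0 := Real.one_lt_goldenRatio
    rintro (_ | _) _ ⟨j, rfl⟩ -
    · dsimp only
      rw [pentagonVertex_eq_pentagonPoint j.2.le, ← pentagonPoint_false,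
        ofPentagon_pentagonPoint_false]
      fin_cases j <;> [refine ⟨2, rfl, mem_halfPlane_right.2 ?_, ?_⟩;
        refine ⟨2, rfl, mem_halfPlane_right.2 ?_, ?_⟩;
        refine ⟨2, rfl, mem_halfPlane_right.2 ?_, ?_⟩;
        refine ⟨3, rfl, mem_halfPlane_upper.2 ?_, ?_⟩;
        refine ⟨3, rfl, mem_halfPlane_upper.2 ?_, ?_⟩] <;>
        simp only [Complex.mk_add_mk, Matrix.cons_val, vertexCoord, mk_mem_goldenL_vertices] <;>
        grind
    · dsimp only
      rw [pentagonVertex_eq_pentagonPoint j.2.le, ofPentagon_pentagonPoint_true]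
      refine ⟨0, rfl, trivial, ?_⟩
      fin_cases j <;>
        simp only [Complex.mk_add_mk, Matrix.cons_val, vertexCoord, mk_mem_goldenL_vertices] <;>
        grind

theorem toPentagon_ofPentagon (z : ℂ) : toPentagon (ofPentagon z) = z := by
  obtain ⟨x, y, rfl⟩ := exists_pentagonPoint_eq true z
  rw [ofPentagon_pentagonPoint_true, toPentagon, columnMap_apply]
  apply Complex.ext <;> simp [pentagonPoint]

theorem ofPentagon_toPentagon (z : ℂ) : ofPentagon (toPentagon z) = z := by
  have h := ofPentagon_mk z.re z.im
  have e : toPentagon z = ⟨z.re + φ / 2 * z.im, sinFifth * z.im⟩ := by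
    refine (columnMap_apply _ _ _ _ z.re z.im).trans ?_
    simp
  rw [e, h]

/-- The affine homeomorphism from the golden L to the double pentagon. -/
noncomputable def pentagonIso : AffineIso goldenL doublePentagon toPentagon ofPentagon :=
  pentagonCutPaste.affineIso pentagonCutPasteInv ofPentagon_toPentagon toPentagon_ofPentagon
    (by
      have h0 := Real.one_lt_goldenRatio
      have hφ := goldenRatio_mul_self
      rintro k ⟨x, y⟩ hz hk
      have h4 := goldenRatio_slope x y
      have h5 := goldenRatio_slope y x
      have hz : (⟨x, y⟩ : ℂ) ∈ goldenLRegion := hz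
      rw [mem_goldenLRegion] at hz
      simp only [pentagonCutPaste, goldenLCutPaste] at hk ⊢
      change Fin 4 at k
      fin_cases k <;>
        simp only [Fin.zero_eta, Fin.mk_one, Fin.reduceFinMk, Fin.isValue,
          Matrix.cons_val, Set.mem_inter_iff, mem_halfPlane, toPentagon_add_true,
          toPentagon_add_lower, toPentagon_add_right, toPentagon_add_upper,
          ofPentagon_pentagonPoint_true, ofPentagon_pentagonPoint_false] at hk ⊢ <;>
        [refine ⟨(0 : Fin 4), rfl, trivial, rfl, ?_⟩;
        refine ⟨(1 : Fin 4), rfl, ⟨mem_halfPlane_left.2 ?_, mem_halfPlane_lower.2 ?_⟩, rfl, ?_⟩;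
        refine ⟨(2 : Fin 4), rfl, mem_halfPlane_right.2 ?_, rfl, ?_⟩;
        refine ⟨(3 : Fin 4), rfl, mem_halfPlane_upper.2 ?_, rfl, ?_⟩] <;>
        try simp only [pentagonCutPasteInv, Matrix.cons_val, Complex.mk_add_mk, Complex.mk.injEq]
      all_goals grind)
    (by
      have h0 := Real.one_lt_goldenRatio
      have hφ := goldenRatio_mul_self
      intro k z hz hk
      obtain ⟨x, y, rfl⟩ := exists_pentagonPoint_eq (pentagonCutPasteInv.src k) z
      replace hz := pentagonPoint_mem_region.1 hz
      obtain ⟨h1, h2, h3, h4, h5⟩ := hz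
      have h6 := goldenRatio_slope x y
      have h7 := goldenRatio_slope y x
      simp only [pentagonCutPasteInv] at hk ⊢
      change Fin 4 at k
      fin_cases k <;>
        simp only [Fin.zero_eta, Fin.mk_one, Fin.reduceFinMk, Fin.isValue, Matrix.cons_val,
          Set.mem_inter_iff, mem_halfPlane_left, mem_halfPlane_right,
          mem_halfPlane_lower, mem_halfPlane_upper, ofPentagon_pentagonPoint_true,
          ofPentagon_pentagonPoint_false, Complex.mk_add_mk] at hk ⊢ <;>
        [refine ⟨(0 : Fin 4), rfl, ?_, rfl, ?_⟩; refine ⟨(1 : Fin 4), rfl, ?_, rfl, ?_⟩;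
        refine ⟨(2 : Fin 4), rfl, ?_, rfl, ?_⟩; refine ⟨(3 : Fin 4), rfl, ?_, rfl, ?_⟩] <;>
        simp only [pentagonCutPaste, goldenLCutPaste, Matrix.cons_val, Set.mem_inter_iff,
          mem_halfPlane, toPentagon_add_true, toPentagon_add_lower, toPentagon_add_right,
          toPentagon_add_upper] <;>
        grind)

theorem pentagonIso_midpoint (J : Label) :
    pentagonIso.toHomeomorph (goldenLMidpoint J) = doublePentagonMidpoint J := by
  have h0 := Real.one_lt_goldenRatio
  have hφ := goldenRatio_mul_self
  -- All five points are midpoints of sides of the inscribed pentagon, so piece 0 serves for every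
  -- label.
  refine toFun_goldenLMidpoint pentagonCutPaste J (0 : Fin 4) ?_ _
    (Same.symm (Same.of_eq (S := doublePentagon) (i := true) ?_ (pentagonMidpointCoord_mem J)))
  · simp only [pentagonCutPaste, goldenLCutPaste]
    cases J <;> simp only [goldenLMidpointCoord, Matrix.cons_val, Set.mem_inter_iff,
      mem_halfPlane] <;> grind
  · have e : pentagonMidpointCoord J = sidePoint true (sideOfLabel J) (1 / 2) := by
      rw [sidePoint_true_eq, pentagonMidpointCoord, midpoint_eq_smul_add, smul_add]
      norm_num
    rw [e]
    simp only [pentagonCutPaste, goldenLCutPaste, Matrix.cons_val]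
    cases J <;> simp only [goldenLMidpointCoord, toPentagon_add_true, sideOfLabel, sidePoint,
      vertexCoord, Fin.isValue, Nat.reduceAdd, Fin.coe_ofNat_eq_mod, Nat.reduceMod] <;>
      congr 1 <;> ring

/-- The derivative of `pentagonIso` is `P`, because `cos (π/5) = φ/2`; hence it takes `v_a` to `P
v_a`. -/
theorem doublePentagon_samePosition (a : TreeWord) (J : Label) :
    SamePosition doublePentagon (pentagonDirection a) (doublePentagonMidpoint J) goldenL
      (goldenLDirection a) (goldenLMidpoint J) := by
  have h := pentagonIso.samePosition (goldenLDirection a) (goldenLMidpoint J)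
  rw [pentagonIso_midpoint] at h
  convert h using 1
  refine Eq.trans ?_ (columnMap_apply _ _ _ _ (wordVector a 0) (wordVector a 1)).symm
  simp [pentagonDirection, goldenToPentagon, Matrix.mulVec, dotProduct, cos_pi_div_five_eq,
    sinFifth, -Real.cos_pi_div_five]

theorem mainTheorem3 (a : TreeWord) :
    (∀ k : Fin 4, labelPerm k * labelPerm k = 1) ∧
    wordPerm (baseWord a) = wordPerm a ∧
    (∀ J : Label,
      (goldenL.InLongCylinder (goldenLDirection (baseWord a)) (goldenLMidpoint J) ↔
        goldenL.InLongCylinder (goldenLDirection a) (goldenLMidpoint J)) ∧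
      (goldenL.InShortCylinder (goldenLDirection (baseWord a)) (goldenLMidpoint J) ↔
        goldenL.InShortCylinder (goldenLDirection a) (goldenLMidpoint J)) ∧
      (goldenL.OnSaddleConnection (goldenLDirection (baseWord a)) (goldenLMidpoint J) ↔
        goldenL.OnSaddleConnection (goldenLDirection a) (goldenLMidpoint J))) ∧
    (∀ J : Label,
      (doublePentagon.InLongCylinder (pentagonDirection (baseWord a)) (doublePentagonMidpoint J) ↔
        doublePentagon.InLongCylinder (pentagonDirection a) (doublePentagonMidpoint J)) ∧
      (doublePentagon.InShortCylinder (pentagonDirection (baseWord a)) (doublePentagonMidpoint J) ↔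
        doublePentagon.InShortCylinder (pentagonDirection a) (doublePentagonMidpoint J)) ∧
      (doublePentagon.OnSaddleConnection (pentagonDirection (baseWord a))
          (doublePentagonMidpoint J) ↔
        doublePentagon.OnSaddleConnection (pentagonDirection a) (doublePentagonMidpoint J))) :=
  ⟨labelPerm_mul_self, wordPerm_baseWord a, goldenL_samePosition_baseWord a, fun J =>
    ((doublePentagon_samePosition (baseWord a) J).trans
      (goldenL_samePosition_baseWord a J)).trans (doublePentagon_samePosition a J).symm⟩
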